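/- Let $r$ be a positive integer and let $R=\bigoplus_{\mathbf n\in\mathbb Z^r}R_{\mathbf n}$ be a commutative Noetherian $\mathbb Z^r$-graded ring that is positively graded ($R_{\mathbf n}=0$ unless $\mathbf n\ge \mathbf 0$ componentwise) and standard ($R=R_{\mathbf 0}[R_{\mathbf e_1},\dots,R_{\mathbf e_r}]$, where $\mathbf e_1,\dots,\mathbf e_r$ is the standard basis of $\mathbb Z^r$). A prefix $*$ refers to the category of $\mathbb Z^r$-graded modules and homogeneous homomorphisms of degree $\mathbf 0$; thus ${}^*E(-)$ denotes the injective envelope in that category. The shift $N(\mathbf b)$ of a graded module $N$ is given by $N(\mathbf b)_{\mathbf n}=N_{\mathbf n+\mathbf b}$. Let $M$ be a $\mathbb Z^r$-graded $R$-module, let $0\to {}^*E^0(M)\to {}^*E^1(M)\to\cdots$ be its minimal $*$injective resolution, and for each $i\ge 0$ let $$\theta_i:{}^*E^i(M)\xrightarrow{\ \cong\ }\bigoplus_{\alpha\in\Lambda_i}{}^*E(R/\mathfrak p_\alpha)(-\mathbf n_\alpha)$$ be a $\mathbb Z^r$-homogeneous isomorphism, where the $\mathfrak p_\alpha$ are graded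 prime ideals of $R$ and $\mathbf n_\alpha\in\mathbb Z^r$. Let $\mathfrak p$ be a graded prime ideal of $R$ containing $R_{(1,\dots,1)}$. Put $\operatorname{dir}(\mathfrak p)=\{j: R_{\mathbf e_j}\subseteq\mathfrak p\}=\{i_1<\dots<i_m\}$ and let $\phi:\mathbb Z^r\to\mathbb Z^m$ be given by $\phi(n_1,\dots,n_r)=(n_{i_1},\dots,n_{i_m})$. For a $\mathbb Z^r$-graded ring or module $L$ let $L^{\phi}$ denote $L$ with the $\mathbb Z^m$-grading $(L^{\phi})_{\mathbf a}=\bigoplus_{\phi(\mathbf n)=\mathbf a}L_{\mathbf n}$. Let $R_{(\mathfrak p)}$ and $M_{(\mathfrak p)}$ be the localizations of $R$ and $M$ at the set of homogeneous elements of $R\setminus\mathfrak p$, with their natural $\mathbb Z^r$-gradings, and let $T=R_{(\mathfrak p)}/\mathfrak pR_{(\mathfrak p)}$. For $i\ge 0$ let ${}^*\mathrm{Ext}^i_{R_{(\mathfrak p)}}(T,M_{(\mathfrak p)})$ be the $i$-th cohomology module of the complex ${}^*\mathrm{Hom}_{R_{(\mathfrak p)}}(T,J^\bullet)$, where $J^\bullet$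 is any $*$injective resolution of $M_{(\mathfrak p)}$ over $R_{(\mathfrak p)}$ (such resolutions exist) and ${}^*\mathrm{Hom}$ is the graded module whose component of degree $\mathbf n$ consists of the homogeneous homomorphisms of degree $\mathbf n$; it is a $\mathbb Z^r$-graded $T$-module. Then, for all $i\ge 0$ and all $\mathbf a\in\mathbb Z^m$, the $(T^{\phi})_{\mathbf 0}$-module $\big({}^*\mathrm{Ext}^i_{R_{(\mathfrak p)}}(T,M_{(\mathfrak p)})^{\phi}\big)_{\mathbf a}$ is free, and $$\#\{\alpha\in\Lambda_i:\ \mathfrak p_\alpha=\mathfrak p\ \text{and}\ \phi(\mathbf n_\alpha)=\mathbf a\}=\operatorname{rank}_{(T^{\phi})_{\mathbf 0}}\Big(\big({}^*\mathrm{Ext}^i_{R_{(\mathfrak p)}}(T,M_{(\mathfrak p)})^{\phi}\big)_{\mathbf a}\Big),$$ as an equality of (possibly infinite) cardinals. -/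

import Mathlib

open DirectSum

universe u

noncomputable section

namespace MultiGraded

section GradedModules

variable {G : Type*} [AddCommGroup G]
variable {R : Type*} [CommRing R]
variable {M : Type*} [AddCommGroup M] [Module R M]
variable {N : Type*} [AddCommGroup N] [Module R N]

/-- The family `ℳ` of additive subgroups makes `M` a `G`-graded module over the ring `R` graded by
`𝒜`. -/
structure IsGradedModule [DecidableEq G] (𝒜 : G → AddSubgroup R) (ℳ : G → AddSubgroup M) :
    Prop where
  gradedSMul : SetLike.GradedSMul 𝒜 ℳ
  isInternal : DirectSum.IsInternal ℳ

/-- `f (M_g) ⊆ N_{g+a}` for all `g`: the `R`-homomorphism `f` is homogeneous of degree `a`. -/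
def IsHomogOfDegree (ℳ : G → AddSubgroup M) (𝒩 : G → AddSubgroup N) (a : G) (f : M →ₗ[R] N) :
    Prop :=
  ∀ g, ∀ x ∈ ℳ g, f x ∈ 𝒩 (g + a)

/-- Morphisms of graded modules: homogeneous homomorphisms of degree `0`. -/
def IsHomog (ℳ : G → AddSubgroup M) (𝒩 : G → AddSubgroup N) (f : M →ₗ[R] N) : Prop :=
  IsHomogOfDegree ℳ 𝒩 0 f

/-- A submodule is graded if it is the sum of its intersections with the graded components. -/
def IsGradedSubmodule (ℳ : G → AddSubgroup M) (L : Submodule R M) : Prop :=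
  L.toAddSubgroup = ⨆ g, L.toAddSubgroup ⊓ ℳ g

/-- `M` is a *essential extension of `L`: every non-zero graded submodule of `M` meets `L`
non-trivially. -/
def IsStarEssential (ℳ : G → AddSubgroup M) (L : Submodule R M) : Prop :=
  ∀ K : Submodule R M, IsGradedSubmodule ℳ K → K ≠ ⊥ → K ⊓ L ≠ ⊥

/-- The shift `M(a)`, with `M(a)_g = M_{g+a}`. -/
def shift (ℳ : G → AddSubgroup M) (a : G) : G → AddSubgroup M := fun g => ℳ (g + a)

/-- The grading of a direct sum of graded modules. -/
def directSumGrading {Λ : Type*} {X : Λ → Type*} [∀ α, AddCommGroup (X α)]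
    (𝒳 : ∀ α, G → AddSubgroup (X α)) (g : G) : AddSubgroup (⨁ α, X α) where
  carrier := {x | ∀ α, x α ∈ 𝒳 α g}
  zero_mem' := fun α => (𝒳 α g).zero_mem
  add_mem' := fun hx hy α => (𝒳 α g).add_mem (hx α) (hy α)
  neg_mem' := fun hx α => (𝒳 α g).neg_mem (hx α)

/-- For a homomorphism `φ : G → H`, the `H`-grading `M^φ`, where `(M^φ)_h` is the sum of the
components `M_g` with `φ g = h`. -/
def regrade {H : Type*} [AddCommGroup H] (φ : G →+ H) (ℳ : G → AddSubgroup M) (h : H) :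
    AddSubgroup M :=
  ⨆ g : {g : G // φ g = h}, ℳ g

/-- The grading of `R ⧸ I` by the images of the components of `R`. -/
def quotGrading (𝒜 : G → AddSubgroup R) (I : Ideal R) (g : G) : AddSubgroup (R ⧸ I) :=
  (𝒜 g).map (Ideal.Quotient.mk I).toAddMonoidHom

instance quotGrading.gradedMonoid (𝒜 : G → AddSubgroup R) [SetLike.GradedMonoid 𝒜]
    (I : Ideal R) : SetLike.GradedMonoid (quotGrading 𝒜 I) where
  one_mem := ⟨1, SetLike.GradedOne.one_mem, map_one (Ideal.Quotient.mk I)⟩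
  mul_mem := by
    rintro i j _ _ ⟨x, hx, rfl⟩ ⟨y, hy, rfl⟩
    exact ⟨x * y, SetLike.GradedMul.mul_mem hx hy, map_mul (Ideal.Quotient.mk I) x y⟩

theorem regrade_smul_mem {H : Type*} [AddCommGroup H] (φ : G →+ H)
    {𝒜 : G → AddSubgroup R} {ℳ : G → AddSubgroup M}
    (hs : ∀ i j, ∀ a ∈ 𝒜 i, ∀ x ∈ ℳ j, a • x ∈ ℳ (i + j))
    {h k : H} {a : R} {x : M} (ha : a ∈ regrade φ 𝒜 h) (hx : x ∈ regrade φ ℳ k) :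
    a • x ∈ regrade φ ℳ (h + k) := by
  refine AddSubgroup.iSup_induction (C := fun a => a • x ∈ regrade φ ℳ (h + k)) _ ha ?_ ?_ ?_
  · rintro ⟨i, hi⟩ a ha
    refine AddSubgroup.iSup_induction (C := fun x => a • x ∈ regrade φ ℳ (h + k)) _ hx ?_ ?_ ?_
    · rintro ⟨j, hj⟩ x hx
      exact AddSubgroup.mem_iSup_of_mem
        (S := fun g : {g : G // φ g = h + k} => ℳ g)
        ⟨i + j, by rw [map_add, hi, hj]⟩ (hs i j a ha x hx)
    · rw [smul_zero]; exact AddSubgroup.zero_mem _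
    · intro x y hx hy
      rw [smul_add]; exact AddSubgroup.add_mem _ hx hy
  · rw [zero_smul]; exact AddSubgroup.zero_mem _
  · intro a b ha hb
    rw [add_smul]; exact AddSubgroup.add_mem _ ha hb

instance regrade.gradedMonoid {H : Type*} [AddCommGroup H] (φ : G →+ H)
    (𝒜 : G → AddSubgroup R) [SetLike.GradedMonoid 𝒜] :
    SetLike.GradedMonoid (regrade (M := R) φ 𝒜) where
  one_mem := AddSubgroup.mem_iSup_of_mem
    (S := fun g : {g : G // φ g = 0} => 𝒜 g) ⟨0, map_zero φ⟩ SetLike.GradedOne.one_mem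
  mul_mem := fun _ _ _ _ ha hb =>
    regrade_smul_mem φ (fun _ _ _ hx _ hy => SetLike.GradedMul.mul_mem hx hy) ha hb

end GradedModules

section Injective

variable {G : Type*} [AddCommGroup G] [DecidableEq G]
variable {R : Type u} [CommRing R] (𝒜 : G → AddSubgroup R)
variable {M : Type u} [AddCommGroup M] [Module R M] (ℳ : G → AddSubgroup M)
variable {E : Type u} [AddCommGroup E] [Module R E] (ℰ : G → AddSubgroup E)

/-- `E` is *injective, that is, an injective object of the category of graded `R`-modules. -/
def IsStarInjective : Prop :=
  ∀ (X Y : Type u) [AddCommGroup X] [Module R X] [AddCommGroup Y] [Module R Y]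
    (𝒳 : G → AddSubgroup X) (𝒴 : G → AddSubgroup Y),
    IsGradedModule 𝒜 𝒳 → IsGradedModule 𝒜 𝒴 →
    ∀ (i : X →ₗ[R] Y) (f : X →ₗ[R] E), IsHomog 𝒳 𝒴 i → Function.Injective i → IsHomog 𝒳 ℰ f →
      ∃ h : Y →ₗ[R] E, IsHomog 𝒴 ℰ h ∧ h ∘ₗ i = f

/-- `e : M → E` is a *injective envelope of `M`. -/
structure IsStarInjectiveEnvelope (e : M →ₗ[R] E) : Prop where
  graded : IsGradedModule 𝒜 ℰ
  injective : IsStarInjective 𝒜 ℰ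
  homog : IsHomog ℳ ℰ e
  mono : Function.Injective e
  essential : IsStarEssential ℰ (LinearMap.range e)

/-- A *injective resolution `0 → M → E⁰ → E¹ → ⋯` of the graded module `M`. -/
structure StarInjectiveResolution where
  obj : ℕ → Type u
  [addCommGroup : ∀ i, AddCommGroup (obj i)]
  [module : ∀ i, Module R (obj i)]
  grading : ∀ i, G → AddSubgroup (obj i)
  graded : ∀ i, IsGradedModule 𝒜 (grading i)
  injective : ∀ i, IsStarInjective 𝒜 (grading i)
  ι : M →ₗ[R] obj 0
  d : ∀ i, obj i →ₗ[R] obj (i + 1)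
  homog_ι : IsHomog ℳ (grading 0) ι
  homog_d : ∀ i, IsHomog (grading i) (grading (i + 1)) (d i)
  mono_ι : Function.Injective ι
  exact_zero : Function.Exact ι (d 0)
  exact_succ : ∀ i, Function.Exact (d i) (d (i + 1))

attribute [instance] StarInjectiveResolution.addCommGroup StarInjectiveResolution.module

variable {𝒜 ℳ}

/-- The resolution is minimal: each term is a *injective envelope of the image of the preceding
map. -/
structure StarInjectiveResolution.IsMinimal (I : StarInjectiveResolution 𝒜 ℳ) : Prop where
  essential_zero : IsStarEssential (I.grading 0) (LinearMap.range I.ι)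
  essential_succ : ∀ i, IsStarEssential (I.grading (i + 1)) (LinearMap.range (I.d i))

end Injective

section Ext

variable {G : Type*} [AddCommGroup G]
variable {R : Type u} [CommRing R]
variable {X : Type u} [AddCommGroup X] [Module R X] (𝒳 : G → AddSubgroup X)
variable {Y : Type u} [AddCommGroup Y] [Module R Y] (𝒴 : G → AddSubgroup Y)

/-- `*Hom_R(X, Y)_a`, the group of homogeneous homomorphisms of degree `a`. -/
def starHomDeg (a : G) : AddSubgroup (X →ₗ[R] Y) where
  carrier := {f | IsHomogOfDegree 𝒳 𝒴 a f}
  zero_mem' := fun g _ _ => (𝒴 (g + a)).zero_mem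
  add_mem' := fun hf hg k x hx => (𝒴 (k + a)).add_mem (hf k x hx) (hg k x hx)
  neg_mem' := fun hf k x hx => (𝒴 (k + a)).neg_mem (hf k x hx)

/-- `*Hom_R(X, Y)`, the `R`-submodule of `Hom_R(X, Y)` generated by the homogeneous homomorphisms of
all degrees. (For graded modules `X`, `Y` over a graded ring `R`, the sum of the groups
`*Hom_R(X, Y)_a` is already an `R`-submodule.) -/
def starHom : Submodule R (X →ₗ[R] Y) :=
  Submodule.span R {f | ∃ a, f ∈ starHomDeg 𝒳 𝒴 a}

variable [DecidableEq G] {𝒜 : G → AddSubgroup R}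
variable {N : Type u} [AddCommGroup N] [Module R N] {𝒩 : G → AddSubgroup N}
variable (J : StarInjectiveResolution 𝒜 𝒩)

/-- The `i`-cocycles of the complex `*Hom_R(X, J)`. -/
def starCocycles (i : ℕ) : Submodule R (X →ₗ[R] J.obj i) :=
  starHom 𝒳 (J.grading i) ⊓ LinearMap.ker (LinearMap.compRight R (M := X) (J.d i))

/-- The `i`-coboundaries of the complex `*Hom_R(X, J)`. -/
def starCoboundaries : (i : ℕ) → Submodule R (X →ₗ[R] J.obj i)
  | 0 => ⊥
  | i + 1 => (starHom 𝒳 (J.grading i)).map (LinearMap.compRight R (M := X) (J.d i))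

/-- `*Ext^i_R(X, N)`, the `i`-th cohomology module of `*Hom_R(X, J)`, where `J` is a *injective
resolution of `N`. -/
def StarExt (i : ℕ) : Type u :=
  starCocycles 𝒳 J i ⧸ (starCoboundaries 𝒳 J i).submoduleOf (starCocycles 𝒳 J i)

instance (i : ℕ) : AddCommGroup (StarExt 𝒳 J i) :=
  inferInstanceAs (AddCommGroup
    (starCocycles 𝒳 J i ⧸ (starCoboundaries 𝒳 J i).submoduleOf (starCocycles 𝒳 J i)))

instance (i : ℕ) : Module R (StarExt 𝒳 J i) :=
  inferInstanceAs (Module R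
    (starCocycles 𝒳 J i ⧸ (starCoboundaries 𝒳 J i).submoduleOf (starCocycles 𝒳 J i)))

/-- The cohomology class of a cocycle. -/
def StarExt.mk (i : ℕ) : starCocycles 𝒳 J i →ₗ[R] StarExt 𝒳 J i :=
  ((starCoboundaries 𝒳 J i).submoduleOf (starCocycles 𝒳 J i)).mkQ

/-- The component `*Ext^i_R(X, N)_g`: the classes of cocycles that are homogeneous of degree `g`. -/
def StarExt.grading (i : ℕ) (g : G) : AddSubgroup (StarExt 𝒳 J i) :=
  ((starHomDeg 𝒳 (J.grading i) g).comap (starCocycles 𝒳 J i).subtype.toAddMonoidHom).map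
    (StarExt.mk 𝒳 J i).toAddMonoidHom

variable (I : Ideal R)

theorem StarExt.isTorsionBySet (i : ℕ) :
    Module.IsTorsionBySet R (StarExt (quotGrading 𝒜 I) J i) I := by
  intro x a
  obtain ⟨z, rfl⟩ : ∃ z, StarExt.mk (quotGrading 𝒜 I) J i z = x :=
    Submodule.mkQ_surjective _ x
  have hz : (a : R) • z = 0 := by
    apply Subtype.ext
    ext
    change (a : R) • (z : R ⧸ I →ₗ[R] J.obj i) 1 = 0
    rw [← map_smul]
    have : (a : R) • (1 : R ⧸ I) = 0 := by
      rw [Algebra.smul_def, mul_one]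
      exact Ideal.Quotient.eq_zero_iff_mem.mpr a.2
    rw [this, map_zero]
  rw [← map_smul, hz, map_zero]

/-- `*Ext^i_R(R/I, N)` is an `R/I`-module, being annihilated by `I`. -/
instance StarExt.quotModule (i : ℕ) : Module (R ⧸ I) (StarExt (quotGrading 𝒜 I) J i) :=
  (StarExt.isTorsionBySet J I i).module

theorem StarExt.smul_mem (i : ℕ) (g h : G) (t : R ⧸ I) (ht : t ∈ quotGrading 𝒜 I g)
    (x : StarExt (quotGrading 𝒜 I) J i) (hx : x ∈ StarExt.grading (quotGrading 𝒜 I) J i h) :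
    t • x ∈ StarExt.grading (quotGrading 𝒜 I) J i (g + h) := by
  obtain ⟨s, hs, rfl⟩ := ht
  obtain ⟨z, hz, rfl⟩ := hx
  refine ⟨s • z, ?_, ?_⟩
  · intro k y hy
    have := (J.graded i).gradedSMul.smul_mem hs (hz k y hy)
    rw [vadd_eq_add, show g + (k + h) = k + (g + h) by abel] at this
    exact this
  · exact map_smul (StarExt.mk (quotGrading 𝒜 I) J i) s z

/-- The subring `((R/I)^φ)_0` of `R/I`. -/
abbrev quotRegradedZero (𝒜 : G → AddSubgroup R) [SetLike.GradedMonoid 𝒜] (I : Ideal R)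
    {H : Type*} [AddCommGroup H] (φ : G →+ H) : Subring (R ⧸ I) :=
  SetLike.GradeZero.subring (regrade (M := R ⧸ I) φ (quotGrading 𝒜 I))

/-- The component `(*Ext^i_R(R/I, N)^φ)_a`, as a module over the subring `((R/I)^φ)_0` of `R/I`. -/
def StarExt.regradedComponent [SetLike.GradedMonoid 𝒜] {H : Type*} [AddCommGroup H] (φ : G →+ H)
    (i : ℕ) (a : H) :
    Submodule (quotRegradedZero 𝒜 I φ) (StarExt (quotGrading 𝒜 I) J i) where
  __ := (regrade φ (StarExt.grading (quotGrading 𝒜 I) J i) a).toAddSubmonoid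
  smul_mem' := by
    rintro ⟨t, ht⟩ x hx
    have := regrade_smul_mem (R := R ⧸ I) φ
      (fun g h t ht x hx => StarExt.smul_mem J I i g h t ht x hx) ht hx
    rw [zero_add] at this
    exact this

end Ext

section Localization

variable {G : Type*} [AddCommGroup G]
variable {R : Type*} [CommRing R] (𝒜 : G → AddSubgroup R) [SetLike.GradedMonoid 𝒜]
variable (p : Ideal R) [p.IsPrime]
variable {M : Type*} [AddCommGroup M] [Module R M] (ℳ : G → AddSubgroup M)

/-- The multiplicative set of homogeneous elements of `R` outside `p`. -/
def homogCompl : Submonoid R := SetLike.homogeneousSubmonoid 𝒜 ⊓ p.primeCompl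

/-- The homogeneous localization `R_(p)`. -/
abbrev HomogLoc : Type _ := Localization (homogCompl 𝒜 p)

/-- The homogeneous localization `M_(p)`. -/
abbrev HomogLocModule (M : Type*) [AddCommGroup M] [Module R M] : Type _ :=
  LocalizedModule (homogCompl 𝒜 p) M

/-- The grading of `M_(p)`: the component of degree `n` consists of the fractions `m / s` with `m`
homogeneous of degree `n + deg s`. -/
def locModuleGrading [SetLike.GradedSMul 𝒜 ℳ] (n : G) : AddSubgroup (HomogLocModule 𝒜 p M) where
  carrier := {x | ∃ (h : G) (m : M) (s : homogCompl 𝒜 p),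
    m ∈ ℳ (n + h) ∧ (s : R) ∈ 𝒜 h ∧ x = LocalizedModule.mk m s}
  zero_mem' := ⟨0, 0, 1, AddSubgroup.zero_mem _, SetLike.GradedOne.one_mem,
    (LocalizedModule.zero_mk _).symm⟩
  add_mem' := by
    rintro _ _ ⟨h, m, s, hm, hs, rfl⟩ ⟨h', m', s', hm', hs', rfl⟩
    refine ⟨h + h', s' • m + s • m', s * s', ?_, SetLike.GradedMul.mul_mem hs hs',
      LocalizedModule.mk_add_mk⟩
    have h1 : (s' : R) • m ∈ ℳ (h' +ᵥ (n + h)) := SetLike.GradedSMul.smul_mem hs' hm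
    have h2 : (s : R) • m' ∈ ℳ (h +ᵥ (n + h')) := SetLike.GradedSMul.smul_mem hs hm'
    rw [vadd_eq_add, show h' + (n + h) = n + (h + h') by abel] at h1
    rw [vadd_eq_add, show h + (n + h') = n + (h + h') by abel] at h2
    exact AddSubgroup.add_mem _ h1 h2
  neg_mem' := by
    rintro _ ⟨h, m, s, hm, hs, rfl⟩
    exact ⟨h, -m, s, AddSubgroup.neg_mem _ hm, hs, LocalizedModule.mk_neg.symm⟩

/-- The grading of the ring `R_(p)`: the component of degree `n` consists of the fractions `a / s`
with `a` homogeneous of degree `n + deg s`. -/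
def locGrading (n : G) : AddSubgroup (HomogLoc 𝒜 p) where
  carrier := {x | ∃ (h : G) (a : R) (s : homogCompl 𝒜 p),
    a ∈ 𝒜 (n + h) ∧ (s : R) ∈ 𝒜 h ∧ x = Localization.mk a s}
  zero_mem' := ⟨0, 0, 1, AddSubgroup.zero_mem _, SetLike.GradedOne.one_mem,
    (Localization.mk_zero _).symm⟩
  add_mem' := by
    rintro _ _ ⟨h, a, s, ha, hs, rfl⟩ ⟨h', a', s', ha', hs', rfl⟩
    refine ⟨h + h', s * a' + s' * a, s * s', ?_, SetLike.GradedMul.mul_mem hs hs',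
      Localization.add_mk _ _ _ _⟩
    have h1 : (s' : R) * a ∈ 𝒜 (h' + (n + h)) := SetLike.GradedMul.mul_mem hs' ha
    have h2 : (s : R) * a' ∈ 𝒜 (h + (n + h')) := SetLike.GradedMul.mul_mem hs ha'
    rw [show h' + (n + h) = n + (h + h') by abel] at h1
    rw [show h + (n + h') = n + (h + h') by abel] at h2
    exact AddSubgroup.add_mem _ h2 h1
  neg_mem' := by
    rintro _ ⟨h, a, s, ha, hs, rfl⟩
    exact ⟨h, -a, s, AddSubgroup.neg_mem _ ha, hs, Localization.neg_mk _ _⟩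

instance locGrading.gradedMonoid : SetLike.GradedMonoid (locGrading 𝒜 p) where
  one_mem := ⟨0, 1, 1, by rw [add_zero]; exact SetLike.GradedOne.one_mem,
    SetLike.GradedOne.one_mem, Localization.mk_one.symm⟩
  mul_mem := by
    rintro n n' _ _ ⟨h, a, s, ha, hs, rfl⟩ ⟨h', a', s', ha', hs', rfl⟩
    refine ⟨h + h', a * a', s * s', ?_, SetLike.GradedMul.mul_mem hs hs',
      Localization.mk_mul _ _ _ _⟩
    rw [show n + n' + (h + h') = (n + h) + (n' + h') by abel]
    exact SetLike.GradedMul.mul_mem ha ha'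

/-- The ideal `p R_(p)`. -/
abbrev locIdeal : Ideal (HomogLoc 𝒜 p) := p.map (algebraMap R (HomogLoc 𝒜 p))

end Localization

section Standard

variable {r : ℕ} {R : Type*} [CommRing R] (𝒜 : (Fin r → ℤ) → AddSubgroup R)

/-- `R_n = 0` unless `n ≥ 0` componentwise. -/
def IsPositivelyGraded : Prop := ∀ n : Fin r → ℤ, ¬ 0 ≤ n → 𝒜 n = ⊥

/-- `R = R_0[R_{e_1}, …, R_{e_r}]`. -/
def IsStandard : Prop :=
  Subring.closure ((𝒜 0 : Set R) ∪ ⋃ j : Fin r, (𝒜 (Pi.single j 1) : Set R)) = ⊤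

open Classical in
/-- `dir(p)`, the set of the `j` with `R_{e_j} ⊆ p`. -/
def dir (p : Ideal R) : Finset (Fin r) :=
  Finset.univ.filter fun j => (𝒜 (Pi.single j 1) : Set R) ⊆ p

/-- `φ(p) : ℤ^r → ℤ^m`, `(n_1, …, n_r) ↦ (n_{i_1}, …, n_{i_m})`, where
`dir(p) = {i_1 < ⋯ < i_m}`. -/
def dirHom (p : Ideal R) : (Fin r → ℤ) →+ (Fin (dir 𝒜 p).card → ℤ) where
  toFun n k := n ((dir 𝒜 p).orderEmbOfFin rfl k)
  map_zero' := rfl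
  map_add' _ _ := rfl

end Standard

end MultiGraded

end

/-!
Localizing the minimal *injective resolution of `M` at `p` gives a *injective resolution of
`M_(p)`: over a Noetherian ring this follows from the graded form of Baer's criterion. Minimality
survives localization, and it forces the differentials to vanish on the elements annihilated by
`p`. As *Ext does not depend on the resolution, `*Ext^i(T, M_(p))` is therefore the `p`-torsion of
the localized `i`-th term. There a summand `*E(R/p)(-n_α)` contributes a copy of `T(-n_α)` and the
other summands contribute nothing, so `*Ext^i(T, M_(p))` has a homogeneous `T`-basis with degrees
`n_α`. Finally, nonzero homogeneous elements of `T` have degree in `ker φ`, hence the basis elements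
with `φ n_α = a` form a basis of the component of degree `a` over `(T^φ)_0`.
-/

noncomputable section

namespace MultiGraded

section Projections

variable {G : Type*} [DecidableEq G] {M : Type*} [AddCommGroup M] {ℳ : G → AddSubgroup M}

/-- The projection of `M = ⨁ M_g` onto its homogeneous component of degree `g`, as an additive
endomorphism of `M`. -/
def proj (h : IsInternal ℳ) (g : G) : M →+ M :=
  letI := h.chooseDecomposition
  (ℳ g).subtype.comp ((DFinsupp.evalAddMonoidHom g).comp (decomposeAddEquiv ℳ).toAddMonoidHom)

theorem proj_mem (h : IsInternal ℳ) (g : G) (x : M) : proj h g x ∈ ℳ g :=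
  SetLike.coe_mem _

theorem proj_of_mem (h : IsInternal ℳ) {g : G} {x : M} (hx : x ∈ ℳ g) : proj h g x = x :=
  letI := h.chooseDecomposition
  decompose_of_mem_same ℳ hx

theorem proj_of_mem_ne (h : IsInternal ℳ) {g k : G} {x : M} (hx : x ∈ ℳ k) (hkg : k ≠ g) :
    proj h g x = 0 :=
  letI := h.chooseDecomposition
  decompose_of_mem_ne ℳ hx hkg

theorem exists_sum_proj_eq (h : IsInternal ℳ) (x : M) :
    ∃ s : Finset G, ∑ g ∈ s, proj h g x = x := by
  classical
  let := h.chooseDecomposition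
  exact ⟨_, sum_support_decompose ℳ x⟩

theorem iSup_eq_top_of_isInternal (h : IsInternal ℳ) : ⨆ g, ℳ g = ⊤ := by
  refine eq_top_iff.mpr fun x _ => ?_
  obtain ⟨s, hs⟩ := exists_sum_proj_eq h x
  exact hs ▸ sum_mem fun g _ => AddSubgroup.mem_iSup_of_mem g (proj_mem h g x)

theorem homogeneous_induction (h : IsInternal ℳ) {P : M → Prop} (hzero : P 0)
    (hadd : ∀ x y, P x → P y → P (x + y)) (hmem : ∀ g, ∀ x ∈ ℳ g, P x) (x : M) : P x := by
  obtain ⟨s, hs⟩ := exists_sum_proj_eq h x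
  exact hs ▸ Finset.sum_induction _ P hadd hzero fun g _ => hmem g _ (proj_mem h g x)

theorem eq_zero_of_forall_proj_eq_zero (h : IsInternal ℳ) {x : M} (hx : ∀ g, proj h g x = 0) :
    x = 0 := by
  obtain ⟨s, hs⟩ := exists_sum_proj_eq h x
  rw [← hs, Finset.sum_eq_zero fun g _ => hx g]

theorem coeAddMonoidHom_surjective_of_iSup_eq_top (top : ⨆ g, ℳ g = ⊤) :
    Function.Surjective (DirectSum.coeAddMonoidHom ℳ) := by
  rw [← AddMonoidHom.range_eq_top, eq_top_iff, ← top, iSup_le_iff]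
  exact fun g x hx => ⟨DirectSum.of (fun g => ℳ g) g ⟨x, hx⟩, DirectSum.coeAddMonoidHom_of _ _ _⟩

theorem isInternal_of_iSup_eq_top_of_proj (top : ⨆ g, ℳ g = ⊤) (π : G → M →+ M)
    (same : ∀ g, ∀ x ∈ ℳ g, π g x = x) (ne : ∀ g k, k ≠ g → ∀ x ∈ ℳ k, π g x = 0) :
    IsInternal ℳ := by
  have apply_coe (x : ⨁ g, ℳ g) (g : G) : π g (DirectSum.coeAddMonoidHom ℳ x) = x g := by
    induction x using DirectSum.induction_on with
    | zero => simp
    | of k x =>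
      rw [DirectSum.coeAddMonoidHom_of]
      obtain rfl | hkg := eq_or_ne k g
      · rw [DirectSum.of_eq_same, same _ _ x.2]
      · rw [DirectSum.of_eq_of_ne _ _ _ hkg.symm, ne _ _ hkg _ x.2, ZeroMemClass.coe_zero]
    | add x y hx hy => rw [map_add, map_add, hx, hy, DirectSum.add_apply, AddSubgroup.coe_add]
  refine ⟨(injective_iff_map_eq_zero _).mpr fun x hx => DFinsupp.ext fun g => Subtype.ext ?_,
    coeAddMonoidHom_surjective_of_iSup_eq_top top⟩
  rw [← apply_coe, hx, map_zero, DFinsupp.zero_apply, ZeroMemClass.coe_zero]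

end Projections

section Homogeneous

variable {G : Type*} [AddCommGroup G] {R : Type*} [CommRing R] {𝒜 : G → AddSubgroup R}
variable {M : Type*} [AddCommGroup M] [Module R M] {ℳ : G → AddSubgroup M}
variable {N : Type*} [AddCommGroup N] [Module R N] {𝒩 : G → AddSubgroup N}
variable {L : Type*} [AddCommGroup L] [Module R L] {ℒ : G → AddSubgroup L}

theorem isHomog_iff {f : M →ₗ[R] N} : IsHomog ℳ 𝒩 f ↔ ∀ g, ∀ x ∈ ℳ g, f x ∈ 𝒩 g := by
  simp only [IsHomog, IsHomogOfDegree, add_zero]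

theorem IsHomog.mem {f : M →ₗ[R] N} (hf : IsHomog ℳ 𝒩 f) {g : G} {x : M} (hx : x ∈ ℳ g) :
    f x ∈ 𝒩 g :=
  isHomog_iff.mp hf g x hx

theorem IsHomogOfDegree.comp {f : M →ₗ[R] N} {k : N →ₗ[R] L} {a : G} (hk : IsHomog 𝒩 ℒ k)
    (hf : IsHomogOfDegree ℳ 𝒩 a f) : IsHomogOfDegree ℳ ℒ a (k ∘ₗ f) :=
  fun g x hx => hk.mem (hf g x hx)

theorem IsHomog.comp {f : M →ₗ[R] N} {k : N →ₗ[R] L} (hk : IsHomog 𝒩 ℒ k)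
    (hf : IsHomog ℳ 𝒩 f) : IsHomog ℳ ℒ (k ∘ₗ f) :=
  IsHomogOfDegree.comp hk hf

theorem IsHomog.sub {f k : M →ₗ[R] N} (hf : IsHomog ℳ 𝒩 f) (hk : IsHomog ℳ 𝒩 k) :
    IsHomog ℳ 𝒩 (f - k) :=
  fun g x hx => sub_mem (hf g x hx) (hk g x hx)

theorem IsHomog.id : IsHomog ℳ ℳ (LinearMap.id : M →ₗ[R] M) :=
  isHomog_iff.mpr fun _ _ hx => hx

variable [DecidableEq G]

theorem IsHomogOfDegree.proj_map {f : M →ₗ[R] N} {a : G} (hf : IsHomogOfDegree ℳ 𝒩 a f)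
    (hℳ : IsInternal ℳ) (h𝒩 : IsInternal 𝒩) (g : G) (x : M) :
    proj h𝒩 (g + a) (f x) = f (proj hℳ g x) := by
  refine homogeneous_induction hℳ (P := fun x => proj h𝒩 (g + a) (f x) = f (proj hℳ g x))
    (by simp) (fun x y hx hy => by simp [hx, hy]) (fun k x hx => ?_) x
  obtain rfl | hkg := eq_or_ne k g
  · rw [proj_of_mem hℳ hx, proj_of_mem h𝒩 (hf _ _ hx)]
  · rw [proj_of_mem_ne hℳ hx hkg, map_zero, proj_of_mem_ne h𝒩 (hf _ _ hx) (by simpa using hkg)]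

theorem IsHomog.proj_map {f : M →ₗ[R] N} (hf : IsHomog ℳ 𝒩 f) (hℳ : IsInternal ℳ)
    (h𝒩 : IsInternal 𝒩) (g : G) (x : M) : proj h𝒩 g (f x) = f (proj hℳ g x) := by
  simpa only [add_zero] using IsHomogOfDegree.proj_map hf hℳ h𝒩 g x

theorem IsGradedModule.smul_mem (hM : IsGradedModule 𝒜 ℳ) {g k : G} {a : R} {x : M}
    (ha : a ∈ 𝒜 g) (hx : x ∈ ℳ k) : a • x ∈ ℳ (k + g) := by
  simpa only [vadd_eq_add, add_comm] using hM.gradedSMul.smul_mem ha hx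

theorem IsGradedModule.of_smul_mem (hℳ : IsInternal ℳ)
    (h : ∀ (g k : G) (a : R) (x : M), a ∈ 𝒜 g → x ∈ ℳ k → a • x ∈ ℳ (k + g)) :
    IsGradedModule 𝒜 ℳ where
  gradedSMul := ⟨fun {g k a x} ha hx => by
    simpa only [vadd_eq_add, add_comm] using h g k a x ha hx⟩
  isInternal := hℳ

theorem IsGradedModule.of_decomposition [Decomposition ℳ] [SetLike.GradedSMul 𝒜 ℳ] :
    IsGradedModule 𝒜 ℳ :=
  ⟨inferInstance, Decomposition.isInternal ℳ⟩

theorem IsGradedModule.self [GradedRing 𝒜] : IsGradedModule 𝒜 𝒜 :=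
  .of_smul_mem (Decomposition.isInternal 𝒜) fun g k a x ha hx => by
    simpa only [smul_eq_mul, mul_comm] using SetLike.GradedMul.mul_mem hx ha

theorem IsGradedModule.proj_smul (hM : IsGradedModule 𝒜 ℳ) {k : G} {a : R} (ha : a ∈ 𝒜 k)
    (g : G) (x : M) : proj hM.isInternal (g + k) (a • x) = a • proj hM.isInternal g x :=
  IsHomogOfDegree.proj_map (f := LinearMap.lsmul R M a) (fun _ _ hx => hM.smul_mem ha hx)
    hM.isInternal hM.isInternal g x

theorem IsGradedModule.shift (hM : IsGradedModule 𝒜 ℳ) (a : G) :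
    IsGradedModule 𝒜 (shift ℳ a) := by
  have top : ⨆ g, MultiGraded.shift ℳ a g = ⊤ :=
    ((Equiv.addRight a).iSup_comp (g := ℳ)).trans (iSup_eq_top_of_isInternal hM.isInternal)
  refine .of_smul_mem (isInternal_of_iSup_eq_top_of_proj top
    (fun g => proj hM.isInternal (g + a)) (fun g x hx => proj_of_mem hM.isInternal hx)
    (fun g k hkg x hx => proj_of_mem_ne hM.isInternal hx (by simpa using hkg)))
    fun g k r x hr hx => ?_
  simpa only [MultiGraded.shift, add_right_comm] using hM.smul_mem hr hx

theorem exists_linearMap_homogeneous_component [GradedRing 𝒜] (hM : IsGradedModule 𝒜 ℳ)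
    (hN : IsGradedModule 𝒜 𝒩) (f : M →ₗ[R] N) (a : G) :
    ∃ f' : M →ₗ[R] N, IsHomogOfDegree ℳ 𝒩 a f' ∧
      ∀ g, ∀ x ∈ ℳ g, f' x = proj hN.isInternal (g + a) (f x) := by
  let := hM.isInternal.chooseDecomposition
  let F : M →+ N := (DirectSum.toAddMonoid fun g =>
    ((proj hN.isInternal (g + a)).comp f.toAddMonoidHom).comp (ℳ g).subtype).comp
      (decomposeAddEquiv ℳ).toAddMonoidHom
  have F_of_mem (g : G) (x : M) (hx : x ∈ ℳ g) : F x = proj hN.isInternal (g + a) (f x) := by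
    simp [F, decompose_of_mem ℳ hx]
  have F_smul (r : R) (x : M) : F (r • x) = r • F x := by
    refine homogeneous_induction (Decomposition.isInternal 𝒜)
      (P := fun r => F (r • x) = r • F x) (by simp) (fun r s hr hs => by simp [add_smul, hr, hs])
      (fun k r hr => ?_) r
    refine homogeneous_induction hM.isInternal (P := fun x => F (r • x) = r • F x) (by simp)
      (fun x y hx hy => by simp [hx, hy]) (fun g x hx => ?_) x
    rw [F_of_mem _ _ (hM.smul_mem hr hx), F_of_mem _ _ hx, map_smul, add_right_comm,
      hN.proj_smul hr]
  refine ⟨{ F with map_smul' := F_smul }, fun g x hx => ?_, F_of_mem⟩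
  exact (F_of_mem g x hx).symm ▸ proj_mem _ _ _

end Homogeneous

section GradedSubmodules

variable {G : Type*} {R : Type*} [CommRing R] {𝒜 : G → AddSubgroup R}
variable {M : Type*} [AddCommGroup M] [Module R M] {ℳ : G → AddSubgroup M} {L : Submodule R M}
variable {N : Type*} [AddCommGroup N] [Module R N] {𝒩 : G → AddSubgroup N}

theorem IsGradedSubmodule.sup {K : Submodule R M} (hK : IsGradedSubmodule ℳ K)
    (hL : IsGradedSubmodule ℳ L) : IsGradedSubmodule ℳ (K ⊔ L) := by
  refine le_antisymm ?_ (iSup_le fun g => inf_le_left)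
  rw [Submodule.sup_toAddSubgroup, hK, hL]
  exact sup_le (iSup_mono fun g => inf_le_inf_right _ (hK ▸ le_sup_left))
    (iSup_mono fun g => inf_le_inf_right _ (hL ▸ le_sup_right))

/-- The grading induced on a submodule. -/
def subGrading (ℳ : G → AddSubgroup M) (L : Submodule R M) (g : G) : AddSubgroup L :=
  (ℳ g).comap L.subtype.toAddMonoidHom

theorem isHomog_subtype [AddCommGroup G] (ℳ : G → AddSubgroup M) (L : Submodule R M) :
    IsHomog (subGrading ℳ L) ℳ L.subtype :=
  isHomog_iff.mpr fun _ _ hx => hx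

variable [DecidableEq G]

theorem isGradedSubmodule_iff_forall_proj_mem (h : IsInternal ℳ) :
    IsGradedSubmodule ℳ L ↔ ∀ x ∈ L, ∀ g, proj h g x ∈ L := by
  refine ⟨fun hL x hx g => ?_,
    fun hL => le_antisymm (fun x hx => ?_) (iSup_le fun g => inf_le_left)⟩
  · replace hx : x ∈ ⨆ g, L.toAddSubgroup ⊓ ℳ g := hL ▸ hx
    refine AddSubgroup.iSup_induction (C := fun x => proj h g x ∈ L) _ hx ?_ (by simp)
      fun x y hx hy => by simpa only [map_add] using L.add_mem hx hy
    rintro k x ⟨hxL, hx⟩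
    obtain rfl | hkg := eq_or_ne k g
    · rwa [proj_of_mem h hx]
    · rw [proj_of_mem_ne h hx hkg]
      exact L.zero_mem
  · obtain ⟨s, hs⟩ := exists_sum_proj_eq h x
    exact hs ▸ sum_mem fun g _ => AddSubgroup.mem_iSup_of_mem g ⟨hL x hx g, proj_mem h g x⟩

theorem IsGradedSubmodule.proj_mem (hL : IsGradedSubmodule ℳ L) (h : IsInternal ℳ) {x : M}
    (hx : x ∈ L) (g : G) : proj h g x ∈ L :=
  (isGradedSubmodule_iff_forall_proj_mem h).mp hL x hx g

variable [AddCommGroup G]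

theorem isGradedSubmodule_of_isHomogeneous [GradedRing 𝒜] {𝔟 : Ideal R}
    (h𝔟 : 𝔟.IsHomogeneous 𝒜) : IsGradedSubmodule 𝒜 𝔟 := by
  refine le_antisymm (fun x hx => ?_) (iSup_le fun g => inf_le_left)
  classical
  rw [← sum_support_decompose 𝒜 x]
  exact sum_mem fun g _ => AddSubgroup.mem_iSup_of_mem g ⟨h𝔟 g hx, SetLike.coe_mem _⟩

theorem IsHomogOfDegree.isGradedSubmodule_comap {f : M →ₗ[R] N} {a : G}
    (hf : IsHomogOfDegree ℳ 𝒩 a f) (hℳ : IsInternal ℳ) (h𝒩 : IsInternal 𝒩)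
    {L : Submodule R N} (hL : IsGradedSubmodule 𝒩 L) : IsGradedSubmodule ℳ (L.comap f) := by
  refine (isGradedSubmodule_iff_forall_proj_mem hℳ).mpr fun x hx g => ?_
  rw [Submodule.mem_comap, ← hf.proj_map hℳ h𝒩]
  exact hL.proj_mem h𝒩 hx _

theorem IsHomog.isGradedSubmodule_range {f : M →ₗ[R] N} (hf : IsHomog ℳ 𝒩 f)
    (hℳ : IsInternal ℳ) (h𝒩 : IsInternal 𝒩) : IsGradedSubmodule 𝒩 (LinearMap.range f) := by
  rw [isGradedSubmodule_iff_forall_proj_mem h𝒩]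
  rintro _ ⟨x, rfl⟩ g
  exact ⟨proj hℳ g x, (hf.proj_map hℳ h𝒩 g x).symm⟩

theorem IsGradedModule.isHomogOfDegree_toSpanSingleton (hM : IsGradedModule 𝒜 ℳ) {g : G} {y : M}
    (hy : y ∈ ℳ g) : IsHomogOfDegree 𝒜 ℳ g (LinearMap.toSpanSingleton R M y) := fun k a ha => by
  simpa only [add_comm, LinearMap.toSpanSingleton_apply] using hM.smul_mem ha hy

theorem IsGradedModule.exists_proj_smul_eq_smul [GradedRing 𝒜] (hM : IsGradedModule 𝒜 ℳ) {g : G}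
    {y : M} (hy : y ∈ ℳ g) (a : R) (k : G) :
    ∃ c ∈ 𝒜 (k - g), proj hM.isInternal k (a • y) = c • y := by
  have proj_smul := (hM.isHomogOfDegree_toSpanSingleton hy).proj_map
    (Decomposition.isInternal 𝒜) hM.isInternal (k - g) a
  rw [sub_add_cancel] at proj_smul
  exact ⟨_, MultiGraded.proj_mem _ _ a, proj_smul⟩

theorem isGradedSubmodule_span_singleton [GradedRing 𝒜] (hM : IsGradedModule 𝒜 ℳ) {g : G} {y : M}
    (hy : y ∈ ℳ g) : IsGradedSubmodule ℳ (Submodule.span R {y}) := by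
  rw [isGradedSubmodule_iff_forall_proj_mem hM.isInternal]
  intro x hx k
  obtain ⟨a, rfl⟩ := Submodule.mem_span_singleton.mp hx
  obtain ⟨c, -, hc⟩ := hM.exists_proj_smul_eq_smul hy a k
  exact Submodule.mem_span_singleton.mpr ⟨c, hc.symm⟩

theorem isGradedSubmodule_torsionBySet (hM : IsGradedModule 𝒜 ℳ) {𝔟 : Ideal R}
    (h𝔟 : IsGradedSubmodule 𝒜 𝔟) : IsGradedSubmodule ℳ (Submodule.torsionBySet R M 𝔟) := by
  refine (isGradedSubmodule_iff_forall_proj_mem hM.isInternal).mpr fun x hx g => ?_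
  rw [Submodule.mem_torsionBySet_iff] at hx ⊢
  rintro ⟨a, ha⟩
  replace ha : a ∈ ⨆ k, 𝔟.toAddSubgroup ⊓ 𝒜 k := h𝔟 ▸ ha
  refine AddSubgroup.iSup_induction (C := fun a => a • proj hM.isInternal g x = 0) _ ha ?_
    (zero_smul _ _) fun a b ha hb => by rw [add_smul, ha, hb, add_zero]
  rintro k a ⟨hab, ha⟩
  rw [← hM.proj_smul ha, hx ⟨a, hab⟩, map_zero]

theorem IsGradedModule.submodule (hM : IsGradedModule 𝒜 ℳ) (hL : IsGradedSubmodule ℳ L) :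
    IsGradedModule 𝒜 (subGrading ℳ L) := by
  let π (g : G) : L →+ L :=
    ((proj hM.isInternal g).comp L.subtype.toAddMonoidHom).codRestrict L.toAddSubgroup
      fun x => hL.proj_mem hM.isInternal x.2 g
  have top : ⨆ g, subGrading ℳ L g = ⊤ := by
    refine eq_top_iff.mpr fun x _ => ?_
    obtain ⟨s, hs⟩ := exists_sum_proj_eq hM.isInternal (x : M)
    have sum_eq : ∑ g ∈ s, π g x = x :=
      Subtype.ext (by rw [AddSubmonoidClass.coe_finsetSum]; exact hs)
    exact sum_eq ▸ sum_mem fun g _ =>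
      AddSubgroup.mem_iSup_of_mem g (MultiGraded.proj_mem hM.isInternal g x.1)
  exact .of_smul_mem (isInternal_of_iSup_eq_top_of_proj top π
    (fun g x hx => Subtype.ext (proj_of_mem hM.isInternal hx))
    (fun g k hkg x hx => Subtype.ext (proj_of_mem_ne hM.isInternal hx hkg)))
    fun g k r x hr hx => hM.smul_mem hr hx

end GradedSubmodules

section Factorization

variable {G : Type*} [AddCommGroup G] [DecidableEq G] {R : Type*} [CommRing R]
variable {B : Type*} [AddCommGroup B] [Module R B] {ℬ : G → AddSubgroup B}
variable {C : Type*} [AddCommGroup C] [Module R C] {𝒞 : G → AddSubgroup C}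
variable {E : Type*} [AddCommGroup E] [Module R E] {ℰ : G → AddSubgroup E}

theorem exists_isHomog_comp_rangeRestrict_eq (hℬ : IsInternal ℬ) (h𝒞 : IsInternal 𝒞)
    {b : B →ₗ[R] C} {v : B →ₗ[R] E} (hb : IsHomog ℬ 𝒞 b) (hv : IsHomog ℬ ℰ v)
    (hker : LinearMap.ker b ≤ LinearMap.ker v) :
    ∃ w : LinearMap.range b →ₗ[R] E,
      IsHomog (subGrading 𝒞 (LinearMap.range b)) ℰ w ∧ w ∘ₗ b.rangeRestrict = v := by
  let w := (LinearMap.ker b).liftQ v hker ∘ₗ b.quotKerEquivRange.symm.toLinearMap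
  have w_apply (x : B) : w (b.rangeRestrict x) = v x := by
    have : b.quotKerEquivRange.symm (b.rangeRestrict x) = Submodule.Quotient.mk x :=
      (LinearEquiv.symm_apply_eq _).mpr rfl
    simp only [w, LinearMap.comp_apply, LinearEquiv.coe_coe, this, Submodule.liftQ_apply]
  refine ⟨w, isHomog_iff.mpr ?_, LinearMap.ext w_apply⟩
  rintro g ⟨_, x, rfl⟩ hx
  have hxg : b.rangeRestrict (proj hℬ g x) = b.rangeRestrict x :=
    Subtype.ext ((hb.proj_map hℬ h𝒞 g x).symm.trans (proj_of_mem h𝒞 hx))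
  change w (b.rangeRestrict x) ∈ ℰ g
  rw [← hxg, w_apply]
  exact hv.mem (proj_mem _ _ _)

end Factorization

/-- A partial homomorphism of graded modules: its domain is a graded submodule, on which it is
homogeneous of degree `0`. -/
structure IsHomogPMap {G R Y E : Type*} [AddCommGroup G] [CommRing R] [AddCommGroup Y] [Module R Y]
    [AddCommGroup E] [Module R E] (𝒴 : G → AddSubgroup Y) (ℰ : G → AddSubgroup E)
    (f : Y →ₗ.[R] E) : Prop where
  domain : IsGradedSubmodule 𝒴 f.domain
  map_mem : ∀ {g : G} {x : f.domain}, (x : Y) ∈ 𝒴 g → f x ∈ ℰ g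

namespace IsHomogPMap

variable {G : Type*} [AddCommGroup G] {R : Type*} [CommRing R] {𝒜 : G → AddSubgroup R}
variable {Y : Type*} [AddCommGroup Y] [Module R Y] {𝒴 : G → AddSubgroup Y}
variable {E : Type*} [AddCommGroup E] [Module R E] {ℰ : G → AddSubgroup E}

variable [DecidableEq G]

theorem sSup {c : Set (Y →ₗ.[R] E)} (h𝒴 : IsInternal 𝒴) (hc : ∀ f ∈ c, IsHomogPMap 𝒴 ℰ f)
    (hne : c.Nonempty) (hdir : DirectedOn (· ≤ ·) c) :
    IsHomogPMap 𝒴 ℰ (LinearPMap.sSup c hdir) := by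
  constructor
  · refine (isGradedSubmodule_iff_forall_proj_mem h𝒴).mpr fun x hx g => ?_
    rw [LinearPMap.mem_domain_sSup_iff hne] at hx ⊢
    obtain ⟨f, hf, hxf⟩ := hx
    exact ⟨f, hf, (hc f hf).domain.proj_mem h𝒴 hxf g⟩
  · rintro g ⟨x, hx⟩ hxg
    obtain ⟨f, hf, hxf⟩ := (LinearPMap.mem_domain_sSup_iff hne hdir).mp hx
    have map_eq := (LinearPMap.le_sSup hdir hf).2 (x := ⟨x, hxf⟩) (y := ⟨x, hx⟩) rfl
    exact map_eq ▸ (hc f hf).map_mem hxg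

theorem sup {f k : Y →ₗ.[R] E} (h𝒴 : IsInternal 𝒴) (hf : IsHomogPMap 𝒴 ℰ f)
    (hk : IsHomogPMap 𝒴 ℰ k) (h : ∀ (x : f.domain) (y : k.domain), (x : Y) = y → f x = k y) :
    IsHomogPMap 𝒴 ℰ (f.sup k h) := by
  refine ⟨hf.domain.sup hk.domain, ?_⟩
  rintro g ⟨x, hx⟩ hxg
  obtain ⟨y, hy, z, hz, rfl⟩ := Submodule.mem_sup.mp hx
  have apply_eq := LinearPMap.sup_apply h ⟨_, hf.domain.proj_mem h𝒴 hy g⟩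
    ⟨_, hk.domain.proj_mem h𝒴 hz g⟩ ⟨_, hx⟩ ((map_add _ _ _).symm.trans (proj_of_mem h𝒴 hxg))
  exact apply_eq ▸ add_mem (hf.map_mem (proj_mem h𝒴 g y)) (hk.map_mem (proj_mem h𝒴 g z))

theorem mkSpanSingleton [GradedRing 𝒜] (hY : IsGradedModule 𝒜 𝒴) (hE : IsGradedModule 𝒜 ℰ)
    {g : G} {y : Y} {e : E} (hy : y ∈ 𝒴 g) (he : e ∈ ℰ g)
    (h : ∀ a : R, a • y = 0 → a • e = 0) :
    IsHomogPMap 𝒴 ℰ (LinearPMap.mkSpanSingleton' y e h) := by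
  refine ⟨isGradedSubmodule_span_singleton hY hy, ?_⟩
  rintro k ⟨x, hx⟩ hxk
  obtain ⟨a, rfl⟩ := Submodule.mem_span_singleton.mp hx
  obtain ⟨l, rfl⟩ : ∃ l, k = l + g := ⟨k - g, (sub_add_cancel k g).symm⟩
  have h𝒜 := Decomposition.isInternal 𝒜
  have smul_y : a • y = proj h𝒜 l a • y := (proj_of_mem hY.isInternal hxk).symm.trans
    ((hY.isHomogOfDegree_toSpanSingleton hy).proj_map h𝒜 hY.isInternal l a)
  have smul_e : a • e = proj h𝒜 l a • e := by
    rw [← sub_eq_zero, ← sub_smul, h _ (by rw [sub_smul, sub_eq_zero, smul_y])]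
  have apply_eq := LinearPMap.mkSpanSingleton'_apply y e h a hx
  exact (apply_eq.trans smul_e) ▸ hE.isHomogOfDegree_toSpanSingleton he l _ (proj_mem h𝒜 l a)

end IsHomogPMap

section Baer

variable {G : Type*} [AddCommGroup G] [DecidableEq G]
variable {R : Type u} [CommRing R] {𝒜 : G → AddSubgroup R}
variable {E : Type u} [AddCommGroup E] [Module R E] {ℰ : G → AddSubgroup E}

/-- The extension property of Baer's criterion: homogeneous homomorphisms `𝔟 → E` of any degree,
defined on a graded ideal `𝔟`, are multiplications by homogeneous elements of `E`. -/
def IsStarBaer (𝒜 : G → AddSubgroup R) (ℰ : G → AddSubgroup E) : Prop :=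
  ∀ 𝔟 : Ideal R, IsGradedSubmodule 𝒜 𝔟 → ∀ (g : G) (f : 𝔟 →ₗ[R] E),
    IsHomogOfDegree (subGrading 𝒜 𝔟) ℰ g f → ∃ e ∈ ℰ g, ∀ b : 𝔟, f b = (b : R) • e

theorem IsStarInjective.isStarBaer [GradedRing 𝒜] (hE : IsStarInjective 𝒜 ℰ) :
    IsStarBaer 𝒜 ℰ := by
  intro 𝔟 h𝔟 g f hf
  have f_homog : IsHomog (shift (subGrading 𝒜 𝔟) (-g)) ℰ f := isHomog_iff.mpr fun k b hb => by
    simpa only [neg_add_cancel_right] using hf _ b hb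
  have subtype_homog : IsHomog (shift (subGrading 𝒜 𝔟) (-g)) (shift 𝒜 (-g)) 𝔟.subtype :=
    isHomog_iff.mpr fun _ _ hb => hb
  obtain ⟨h, h_homog, h_comp⟩ := hE 𝔟 R _ _
    ((IsGradedModule.self.submodule h𝔟).shift (-g)) (IsGradedModule.self.shift (-g))
    𝔟.subtype f subtype_homog 𝔟.injective_subtype f_homog
  refine ⟨h 1, h_homog.mem ?_, fun b => ?_⟩
  · simpa only [shift, add_neg_cancel] using SetLike.GradedOne.one_mem (A := 𝒜)
  · rw [← h_comp, ← map_smul, smul_eq_mul, mul_one]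
    rfl

theorem IsHomogPMap.exists_le_mem_domain [GradedRing 𝒜] (hE : IsGradedModule 𝒜 ℰ)
    (hBaer : IsStarBaer 𝒜 ℰ) {Y : Type*} [AddCommGroup Y] [Module R Y] {𝒴 : G → AddSubgroup Y}
    (hY : IsGradedModule 𝒜 𝒴) {f : Y →ₗ.[R] E} (hf : IsHomogPMap 𝒴 ℰ f) {g : G} {y : Y}
    (hy : y ∈ 𝒴 g) : ∃ k, IsHomogPMap 𝒴 ℰ k ∧ f ≤ k ∧ y ∈ k.domain := by
  let 𝔟 : Ideal R := f.domain.comap (LinearMap.toSpanSingleton R Y y)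
  let v : 𝔟 →ₗ[R] E := f.toFun ∘ₗ (LinearMap.toSpanSingleton R Y y).restrict fun _ hb => hb
  have y_homog := hY.isHomogOfDegree_toSpanSingleton hy
  obtain ⟨e, he, hve⟩ := hBaer 𝔟
    (y_homog.isGradedSubmodule_comap (Decomposition.isInternal 𝒜) hY.isInternal hf.domain) g v
    fun l b hb => hf.map_mem (y_homog l b hb)
  have f_smul (a : R) (ha : a • y ∈ f.domain) : f ⟨a • y, ha⟩ = a • e := hve ⟨a, ha⟩
  have smul_e (a : R) (ha : a • y = 0) : a • e = 0 := by
    rw [← f_smul a (ha ▸ f.domain.zero_mem), ← f.map_zero]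
    exact congrArg f (Subtype.ext ha)
  let q : Y →ₗ.[R] E := LinearPMap.mkSpanSingleton' y e smul_e
  have agree (x : f.domain) (z : q.domain) (hxz : (x : Y) = z) : f x = q z := by
    obtain ⟨⟨x, hx⟩, ⟨z, hz⟩⟩ := x, z
    obtain ⟨a, rfl⟩ := Submodule.mem_span_singleton.mp hz
    obtain rfl : x = a • y := hxz
    exact (f_smul a hx).trans (LinearPMap.mkSpanSingleton'_apply y e smul_e a hz).symm
  exact ⟨f.sup q agree, hf.sup hY.isInternal (.mkSpanSingleton hY hE hy he smul_e) agree,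
    LinearPMap.left_le_sup _ _ _, Submodule.mem_sup_right (Submodule.mem_span_singleton_self y)⟩

theorem IsHomogPMap.exists_isHomog_extension [GradedRing 𝒜] (hE : IsGradedModule 𝒜 ℰ)
    (hBaer : IsStarBaer 𝒜 ℰ) {Y : Type*} [AddCommGroup Y] [Module R Y] {𝒴 : G → AddSubgroup Y}
    (hY : IsGradedModule 𝒜 𝒴) {f : Y →ₗ.[R] E} (hf : IsHomogPMap 𝒴 ℰ f) :
    ∃ h : Y →ₗ[R] E, IsHomog 𝒴 ℰ h ∧ ∀ x : f.domain, h x = f x := by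
  obtain ⟨m, hfm, hm, hmax⟩ := zorn_le_nonempty₀ {k : Y →ₗ.[R] E | IsHomogPMap 𝒴 ℰ k}
    (fun c hc hchain y hy => ⟨LinearPMap.sSup c hchain.directedOn,
      .sSup hY.isInternal hc ⟨y, hy⟩ _, fun _ => LinearPMap.le_sSup hchain.directedOn⟩) f hf
  have mem_domain : ∀ y, y ∈ m.domain :=
    homogeneous_induction hY.isInternal (zero_mem _) (fun _ _ => add_mem) fun g y hy => by
      obtain ⟨k, hk, hmk, hyk⟩ := IsHomogPMap.exists_le_mem_domain hE hBaer hY hm hy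
      exact (hmax hk hmk).1 hyk
  exact ⟨m.toFun ∘ₗ LinearMap.codRestrict m.domain LinearMap.id mem_domain,
    isHomog_iff.mpr fun g y hy => hm.map_mem (x := ⟨y, mem_domain y⟩) hy,
    fun x => (hfm.2 (x := x) (y := ⟨x, mem_domain x⟩) rfl).symm⟩

theorem IsStarBaer.isStarInjective [GradedRing 𝒜] (hBaer : IsStarBaer 𝒜 ℰ)
    (hE : IsGradedModule 𝒜 ℰ) : IsStarInjective 𝒜 ℰ := by
  intro X Y _ _ _ _ 𝒳 𝒴 hX hY i f hi hinj hf
  obtain ⟨w, hw, hwi⟩ := exists_isHomog_comp_rangeRestrict_eq hX.isInternal hY.isInternal hi hf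
    (by simp only [LinearMap.ker_eq_bot.mpr hinj, bot_le])
  obtain ⟨h, hh, hhw⟩ := IsHomogPMap.exists_isHomog_extension hE hBaer hY
    (f := ⟨LinearMap.range i, w⟩) ⟨hi.isGradedSubmodule_range hX.isInternal hY.isInternal, hw.mem⟩
  refine ⟨h, hh, LinearMap.ext fun x => ?_⟩
  exact (hhw (i.rangeRestrict x)).trans (LinearMap.congr_fun hwi x)

theorem IsStarInjective.exists_comp_eq (hE : IsStarInjective 𝒜 ℰ)
    {B C : Type u} [AddCommGroup B] [Module R B] [AddCommGroup C] [Module R C]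
    {ℬ : G → AddSubgroup B} {𝒞 : G → AddSubgroup C}
    (hB : IsGradedModule 𝒜 ℬ) (hC : IsGradedModule 𝒜 𝒞)
    {b : B →ₗ[R] C} {v : B →ₗ[R] E} (hb : IsHomog ℬ 𝒞 b) (hv : IsHomog ℬ ℰ v)
    (hker : LinearMap.ker b ≤ LinearMap.ker v) :
    ∃ w : C →ₗ[R] E, IsHomog 𝒞 ℰ w ∧ w ∘ₗ b = v := by
  obtain ⟨v', hv', hv'b⟩ :=
    exists_isHomog_comp_rangeRestrict_eq hB.isInternal hC.isInternal hb hv hker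
  obtain ⟨w, hw, hwv'⟩ := hE _ C _ 𝒞
    (hC.submodule (hb.isGradedSubmodule_range hB.isInternal hC.isInternal)) hC
    (LinearMap.range b).subtype v' (isHomog_subtype 𝒞 _) (Submodule.injective_subtype _) hv'
  exact ⟨w, hw, by rw [← hv'b, ← hwv']; rfl⟩

end Baer

section Comparison

theorem exists_dependent_sequence {X : ℕ → Type*} (P : ∀ i, X i → Prop)
    (Q : ∀ i, X i → X (i + 1) → Prop) (x₀ : X 0) (h₀ : P 0 x₀)
    (hs : ∀ i x, P i x → ∃ y, P (i + 1) y ∧ Q i x y) :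
    ∃ f : ∀ i, X i, f 0 = x₀ ∧ (∀ i, P i (f i)) ∧ ∀ i, Q i (f i) (f (i + 1)) := by
  choose next hP hQ using hs
  let F : ∀ i, {x : X i // P i x} := fun i =>
    Nat.rec ⟨x₀, h₀⟩ (fun i x => ⟨next i x.1 x.2, hP i x.1 x.2⟩) i
  exact ⟨fun i => (F i).1, rfl, fun i => (F i).2, fun i => hQ i (F i).1 (F i).2⟩

variable {G : Type*} [AddCommGroup G] [DecidableEq G]
variable {R : Type u} [CommRing R] {𝒜 : G → AddSubgroup R}
variable {N : Type u} [AddCommGroup N] [Module R N] {𝒩 : G → AddSubgroup N}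

/-- A morphism of *injective resolutions of `N` over the identity of `N`: a cochain map that is
homogeneous of degree `0` and compatible with the coaugmentations. -/
structure Comparison (J K : StarInjectiveResolution 𝒜 𝒩) where
  map : ∀ i, J.obj i →ₗ[R] K.obj i
  homog : ∀ i, IsHomog (J.grading i) (K.grading i) (map i)
  map_ι : map 0 ∘ₗ J.ι = K.ι
  map_d : ∀ i, map (i + 1) ∘ₗ J.d i = K.d i ∘ₗ map i

namespace StarInjectiveResolution

theorem d_comp_ι (J : StarInjectiveResolution 𝒜 𝒩) : J.d 0 ∘ₗ J.ι = 0 :=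
  J.exact_zero.linearMap_comp_eq_zero

theorem d_comp_d (J : StarInjectiveResolution 𝒜 𝒩) (i : ℕ) : J.d (i + 1) ∘ₗ J.d i = 0 :=
  (J.exact_succ i).linearMap_comp_eq_zero

theorem ker_d_zero_le_ker (J : StarInjectiveResolution 𝒜 𝒩) {E : Type*} [AddCommGroup E]
    [Module R E] {f : J.obj 0 →ₗ[R] E} (hf : f ∘ₗ J.ι = 0) :
    LinearMap.ker (J.d 0) ≤ LinearMap.ker f := by
  rw [J.exact_zero.linearMap_ker_eq]
  exact LinearMap.range_le_ker_iff.mpr hf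

theorem ker_d_succ_le_ker (J : StarInjectiveResolution 𝒜 𝒩) {E : Type*} [AddCommGroup E]
    [Module R E] {i : ℕ} {f : J.obj (i + 1) →ₗ[R] E} (hf : f ∘ₗ J.d i = 0) :
    LinearMap.ker (J.d (i + 1)) ≤ LinearMap.ker f := by
  rw [(J.exact_succ i).linearMap_ker_eq]
  exact LinearMap.range_le_ker_iff.mpr hf

end StarInjectiveResolution

namespace Comparison

variable {J K L : StarInjectiveResolution 𝒜 𝒩}

/-- The identity morphism of a *injective resolution. -/
def refl (J : StarInjectiveResolution 𝒜 𝒩) : Comparison J J where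
  map _ := LinearMap.id
  homog _ := .id
  map_ι := rfl
  map_d _ := rfl

/-- The composition of morphisms of *injective resolutions. -/
def comp (k : Comparison K L) (f : Comparison J K) : Comparison J L where
  map i := k.map i ∘ₗ f.map i
  homog i := (k.homog i).comp (f.homog i)
  map_ι := by rw [LinearMap.comp_assoc, f.map_ι, k.map_ι]
  map_d i := by rw [LinearMap.comp_assoc, f.map_d, ← LinearMap.comp_assoc, k.map_d]; rfl

theorem nonempty (hN : IsGradedModule 𝒜 𝒩) (J K : StarInjectiveResolution 𝒜 𝒩) :
    Nonempty (Comparison J K) := by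
  obtain ⟨f₀, hf₀, hf₀ι⟩ := (K.injective 0).exists_comp_eq hN (J.graded 0) J.homog_ι K.homog_ι
    (by simp only [LinearMap.ker_eq_bot.mpr J.mono_ι, bot_le])
  obtain ⟨f, rfl, hf, hfd⟩ := exists_dependent_sequence
    (X := fun i => J.obj i →ₗ[R] K.obj i)
    (fun i f => IsHomog (J.grading i) (K.grading i) f ∧
      LinearMap.ker (J.d i) ≤ LinearMap.ker (K.d i ∘ₗ f))
    (fun i f f' => f' ∘ₗ J.d i = K.d i ∘ₗ f) f₀
    ⟨hf₀, J.ker_d_zero_le_ker (by rw [LinearMap.comp_assoc, hf₀ι, K.d_comp_ι])⟩ <| by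
      rintro i f ⟨hf, hker⟩
      obtain ⟨f', hf', hf'd⟩ := (K.injective (i + 1)).exists_comp_eq (J.graded i)
        (J.graded (i + 1)) (J.homog_d i) ((K.homog_d i).comp hf) hker
      exact ⟨f', ⟨hf', J.ker_d_succ_le_ker (by
        rw [LinearMap.comp_assoc, hf'd, ← LinearMap.comp_assoc, K.d_comp_d, LinearMap.zero_comp])⟩,
        hf'd⟩
  exact ⟨⟨f, fun i => (hf i).1, hf₀ι, hfd⟩⟩

theorem exists_homotopy (f f' : Comparison J K) :
    ∃ h : ∀ i, J.obj (i + 1) →ₗ[R] K.obj i,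
      (∀ i, IsHomog (J.grading (i + 1)) (K.grading i) (h i)) ∧
      f.map 0 - f'.map 0 = h 0 ∘ₗ J.d 0 ∧
      ∀ i, f.map (i + 1) - f'.map (i + 1) = h (i + 1) ∘ₗ J.d (i + 1) + K.d i ∘ₗ h i := by
  let δ i := f.map i - f'.map i
  have δ_homog i : IsHomog (J.grading i) (K.grading i) (δ i) := (f.homog i).sub (f'.homog i)
  have δ_ι : δ 0 ∘ₗ J.ι = 0 := by rw [LinearMap.sub_comp, f.map_ι, f'.map_ι, sub_self]
  have δ_d i : δ (i + 1) ∘ₗ J.d i = K.d i ∘ₗ δ i := by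
    rw [LinearMap.sub_comp, f.map_d, f'.map_d, ← LinearMap.comp_sub]
  obtain ⟨h₀, hh₀, hh₀d⟩ := (K.injective 0).exists_comp_eq (J.graded 0) (J.graded 1) (J.homog_d 0)
    (δ_homog 0) (J.ker_d_zero_le_ker δ_ι)
  obtain ⟨h, rfl, hh, hhd⟩ := exists_dependent_sequence
    (X := fun i => J.obj (i + 1) →ₗ[R] K.obj i)
    (fun i h => IsHomog (J.grading (i + 1)) (K.grading i) h ∧
      K.d i ∘ₗ h ∘ₗ J.d i = K.d i ∘ₗ δ i)
    (fun i h h' => h' ∘ₗ J.d (i + 1) = δ (i + 1) - K.d i ∘ₗ h) h₀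
    ⟨hh₀, by rw [hh₀d]⟩ <| by
      rintro i h ⟨hh, hhd⟩
      obtain ⟨h', hh', hh'd⟩ := (K.injective (i + 1)).exists_comp_eq (J.graded (i + 1))
        (J.graded (i + 2)) (J.homog_d (i + 1)) ((δ_homog (i + 1)).sub ((K.homog_d i).comp hh))
        (J.ker_d_succ_le_ker (by
          rw [LinearMap.sub_comp, δ_d, LinearMap.comp_assoc, hhd, sub_self]))
      refine ⟨h', ⟨hh', ?_⟩, hh'd⟩
      rw [hh'd, LinearMap.comp_sub, ← LinearMap.comp_assoc, K.d_comp_d, LinearMap.zero_comp,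
        sub_zero]
  exact ⟨h, fun i => (hh i).1, hh₀d.symm, fun i => by rw [hhd, sub_add_cancel]⟩

end Comparison

end Comparison

section ExtFunctoriality

variable {G : Type*} [AddCommGroup G] {R : Type u} [CommRing R]
variable {X : Type u} [AddCommGroup X] [Module R X] {𝒳 : G → AddSubgroup X}
variable {Y : Type u} [AddCommGroup Y] [Module R Y] {𝒴 : G → AddSubgroup Y}
variable {Z : Type u} [AddCommGroup Z] [Module R Z] {𝒵 : G → AddSubgroup Z}

theorem IsHomog.comp_mem_starHom {f : Y →ₗ[R] Z} (hf : IsHomog 𝒴 𝒵 f) {z : X →ₗ[R] Y}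
    (hz : z ∈ starHom 𝒳 𝒴) : f ∘ₗ z ∈ starHom 𝒳 𝒵 := by
  suffices starHom 𝒳 𝒴 ≤ (starHom 𝒳 𝒵).comap (LinearMap.compRight R f) from this hz
  refine Submodule.span_le.mpr ?_
  rintro z ⟨a, hz⟩
  exact Submodule.subset_span ⟨a, IsHomogOfDegree.comp hf hz⟩

variable [DecidableEq G] {𝒜 : G → AddSubgroup R}
variable {N : Type u} [AddCommGroup N] [Module R N] {𝒩 : G → AddSubgroup N}
variable {J K L : StarInjectiveResolution 𝒜 𝒩}

theorem mem_starCocycles {i : ℕ} {z : X →ₗ[R] J.obj i} :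
    z ∈ starCocycles 𝒳 J i ↔ z ∈ starHom 𝒳 (J.grading i) ∧ J.d i ∘ₗ z = 0 :=
  Iff.rfl

theorem Comparison.comp_mem_starCocycles (f : Comparison J K) {i : ℕ} {z : X →ₗ[R] J.obj i}
    (hz : z ∈ starCocycles 𝒳 J i) : f.map i ∘ₗ z ∈ starCocycles 𝒳 K i := by
  rw [mem_starCocycles] at hz ⊢
  refine ⟨(f.homog i).comp_mem_starHom hz.1, ?_⟩
  rw [← LinearMap.comp_assoc, ← f.map_d, LinearMap.comp_assoc, hz.2, LinearMap.comp_zero]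

theorem Comparison.comp_mem_starCoboundaries (f : Comparison J K) :
    ∀ {i : ℕ} {z : X →ₗ[R] J.obj i}, z ∈ starCoboundaries 𝒳 J i →
      f.map i ∘ₗ z ∈ starCoboundaries 𝒳 K i
  | 0, z, hz => by
    rw [(Submodule.mem_bot R).mp hz, LinearMap.comp_zero]
    exact zero_mem _
  | i + 1, _, ⟨w, hw, rfl⟩ => by
    refine ⟨f.map i ∘ₗ w, (f.homog i).comp_mem_starHom hw, ?_⟩
    change K.d i ∘ₗ f.map i ∘ₗ w = f.map (i + 1) ∘ₗ J.d i ∘ₗ w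
    rw [← LinearMap.comp_assoc, ← f.map_d, LinearMap.comp_assoc]

theorem Comparison.comp_sub_comp_mem_starCoboundaries (f f' : Comparison J K) {i : ℕ}
    {z : X →ₗ[R] J.obj i} (hz : z ∈ starCocycles 𝒳 J i) :
    f.map i ∘ₗ z - f'.map i ∘ₗ z ∈ starCoboundaries 𝒳 K i := by
  rw [← LinearMap.sub_comp]
  obtain ⟨h, h_homog, h_zero, h_succ⟩ := f.exists_homotopy f'
  obtain ⟨hz, hdz⟩ := mem_starCocycles.mp hz
  cases i with
  | zero =>
    rw [h_zero, LinearMap.comp_assoc, hdz, LinearMap.comp_zero]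
    exact zero_mem _
  | succ i =>
    rw [h_succ, LinearMap.add_comp, LinearMap.comp_assoc, hdz, LinearMap.comp_zero, zero_add]
    exact ⟨h i ∘ₗ z, (h_homog i).comp_mem_starHom hz, rfl⟩

namespace StarExt

theorem mk_surjective (i : ℕ) : Function.Surjective (StarExt.mk 𝒳 J i) :=
  Submodule.mkQ_surjective _

theorem mk_eq_mk_iff {i : ℕ} {z w : starCocycles 𝒳 J i} :
    StarExt.mk 𝒳 J i z = StarExt.mk 𝒳 J i w ↔
      (z : X →ₗ[R] J.obj i) - w ∈ starCoboundaries 𝒳 J i :=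
  Submodule.Quotient.eq _

/-- The homomorphism `*Ext^i(X, N) → *Ext^i(X, N)`, computed with two resolutions `J` and `K` of
`N`, that is induced by a morphism `J → K`. -/
def map (𝒳 : G → AddSubgroup X) (f : Comparison J K) (i : ℕ) :
    StarExt 𝒳 J i →ₗ[R] StarExt 𝒳 K i :=
  Submodule.mapQ _ _
    ((LinearMap.compRight R (f.map i)).restrict fun _ hz => f.comp_mem_starCocycles hz)
    fun _ hz => f.comp_mem_starCoboundaries hz

theorem map_mk (f : Comparison J K) {i : ℕ} (z : starCocycles 𝒳 J i) :
    map 𝒳 f i (StarExt.mk 𝒳 J i z) =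
      StarExt.mk 𝒳 K i ⟨f.map i ∘ₗ z, f.comp_mem_starCocycles z.2⟩ :=
  rfl

theorem isHomog_map (f : Comparison J K) (i : ℕ) :
    IsHomog (StarExt.grading 𝒳 J i) (StarExt.grading 𝒳 K i) (map 𝒳 f i) := by
  rw [isHomog_iff]
  rintro g _ ⟨z, hz, rfl⟩
  exact ⟨_, IsHomogOfDegree.comp (f.homog i) hz, (map_mk f z).symm⟩

theorem map_eq (f f' : Comparison J K) (i : ℕ) : map 𝒳 f i = map 𝒳 f' i := by
  refine LinearMap.ext fun x => ?_
  obtain ⟨z, rfl⟩ := mk_surjective i x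
  rw [map_mk, map_mk, mk_eq_mk_iff]
  exact f.comp_sub_comp_mem_starCoboundaries f' z.2

theorem map_comp_map_eq_id (k : Comparison K J) (f : Comparison J K) (i : ℕ) :
    map 𝒳 k i ∘ₗ map 𝒳 f i = LinearMap.id := by
  have map_comp : map 𝒳 k i ∘ₗ map 𝒳 f i = map 𝒳 (k.comp f) i := LinearMap.ext fun x => by
    obtain ⟨z, rfl⟩ := mk_surjective i x
    rfl
  have map_refl : map 𝒳 (Comparison.refl J) i = LinearMap.id := LinearMap.ext fun x => by
    obtain ⟨z, rfl⟩ := mk_surjective i x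
    rfl
  rw [map_comp, map_eq (k.comp f) (.refl J), map_refl]

theorem exists_equiv (hN : IsGradedModule 𝒜 𝒩) (𝒳 : G → AddSubgroup X)
    (J K : StarInjectiveResolution 𝒜 𝒩) (i : ℕ) :
    ∃ Ψ : StarExt 𝒳 J i ≃ₗ[R] StarExt 𝒳 K i,
      IsHomog (StarExt.grading 𝒳 J i) (StarExt.grading 𝒳 K i) Ψ.toLinearMap ∧
      IsHomog (StarExt.grading 𝒳 K i) (StarExt.grading 𝒳 J i) Ψ.symm.toLinearMap := by
  obtain ⟨⟨f⟩, ⟨k⟩⟩ := Comparison.nonempty hN J K, Comparison.nonempty hN K J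
  exact ⟨.ofLinearMap (map 𝒳 f i) (map 𝒳 k i) (map_comp_map_eq_id f k i) (map_comp_map_eq_id k f i),
    isHomog_map f i, isHomog_map k i⟩

end StarExt

end ExtFunctoriality

section Torsion

variable {R : Type u} [CommRing R]

theorem linearMap_quotient_apply_mk {I : Ideal R} {M : Type*} [AddCommGroup M] [Module R M]
    (f : (R ⧸ I) →ₗ[R] M) (r : R) : f (Ideal.Quotient.mk I r) = r • f 1 := by
  rw [← map_smul, Algebra.smul_def, mul_one, Ideal.Quotient.algebraMap_eq]

theorem apply_one_mem_torsionBySet {I : Ideal R} {M : Type*} [AddCommGroup M] [Module R M]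
    (f : (R ⧸ I) →ₗ[R] M) : f 1 ∈ Submodule.torsionBySet R M (I : Set R) := by
  rw [Submodule.mem_torsionBySet_iff]
  rintro ⟨a, ha⟩
  rw [← linearMap_quotient_apply_mk, Ideal.Quotient.eq_zero_iff_mem.mpr ha, map_zero]

/-- The isomorphism `Hom(R/I, M) ≃ (0 :_M I)` given by evaluation at `1`. -/
def quotHomEquivTorsion (I : Ideal R) (M : Type*) [AddCommGroup M] [Module R M] :
    ((R ⧸ I) →ₗ[R] M) ≃ₗ[R] Submodule.torsionBySet R M (I : Set R) where
  toFun f := ⟨f 1, apply_one_mem_torsionBySet f⟩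
  map_add' _ _ := rfl
  map_smul' _ _ := rfl
  invFun x := Submodule.liftQ I (LinearMap.toSpanSingleton R M x) fun a ha =>
    (Submodule.mem_torsionBySet_iff _ _).mp x.2 ⟨a, ha⟩
  left_inv f := Submodule.linearMap_qext _ <| LinearMap.ext_ring <| one_smul R (f 1)
  right_inv x := Subtype.ext <| one_smul R (x : M)

variable {G : Type*} [AddCommGroup G] {𝒜 : G → AddSubgroup R} {I : Ideal R}

section StarHom

variable {M : Type u} [AddCommGroup M] [Module R M] {ℳ : G → AddSubgroup M} [DecidableEq G]

theorem mem_starHomDeg_quotGrading_iff [SetLike.GradedMonoid 𝒜] (hM : IsGradedModule 𝒜 ℳ) {g : G}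
    {f : (R ⧸ I) →ₗ[R] M} : f ∈ starHomDeg (quotGrading 𝒜 I) ℳ g ↔ f 1 ∈ ℳ g := by
  refine ⟨fun hf => ?_, fun hf => ?_⟩
  · simpa only [zero_add] using hf 0 1 SetLike.GradedOne.one_mem
  · rintro k _ ⟨a, ha, rfl⟩
    change f (Ideal.Quotient.mk I a) ∈ ℳ (k + g)
    rw [linearMap_quotient_apply_mk, add_comm]
    exact hM.smul_mem ha hf

theorem starHom_quotGrading_eq_top [SetLike.GradedMonoid 𝒜] (hI : IsGradedSubmodule 𝒜 I)
    (hM : IsGradedModule 𝒜 ℳ) : starHom (R := R) (quotGrading 𝒜 I) ℳ = ⊤ := by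
  have torsion_graded := hM.submodule (isGradedSubmodule_torsionBySet hM hI)
  refine eq_top_iff.mpr fun f _ => ?_
  obtain ⟨x, rfl⟩ := (quotHomEquivTorsion I M).symm.surjective f
  refine homogeneous_induction torsion_graded.isInternal
    (P := fun x => (quotHomEquivTorsion I M).symm x ∈ starHom (quotGrading 𝒜 I) ℳ)
    (by simp) (fun x y hx hy => by rw [map_add]; exact add_mem hx hy) (fun g x hx => ?_) x
  refine Submodule.subset_span ⟨g, (mem_starHomDeg_quotGrading_iff hM).mpr ?_⟩
  change (quotHomEquivTorsion I M ((quotHomEquivTorsion I M).symm x) : M) ∈ ℳ g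
  rwa [LinearEquiv.apply_symm_apply]

end StarHom

namespace StarExt

variable {N : Type u} [AddCommGroup N] [Module R N] {𝒩 : G → AddSubgroup N} [DecidableEq G]
  {K : StarInjectiveResolution 𝒜 𝒩}

theorem starCoboundaries_quotGrading_eq_bot
    (hK : ∀ i, ∀ x ∈ Submodule.torsionBySet R (K.obj i) (I : Set R), K.d i x = 0) :
    ∀ i, starCoboundaries (quotGrading 𝒜 I) K i = ⊥
  | 0 => rfl
  | i + 1 => by
    rw [eq_bot_iff]
    rintro _ ⟨f, -, rfl⟩
    exact Submodule.linearMap_qext _ <| LinearMap.ext_ring <|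
      hK i _ (apply_one_mem_torsionBySet f)

variable [SetLike.GradedMonoid 𝒜]

theorem starCocycles_quotGrading_eq_top (hI : IsGradedSubmodule 𝒜 I) {i : ℕ}
    (hK : ∀ x ∈ Submodule.torsionBySet R (K.obj i) (I : Set R), K.d i x = 0) :
    starCocycles (quotGrading 𝒜 I) K i = ⊤ := by
  refine eq_top_iff.mpr fun f _ => mem_starCocycles.mpr ⟨?_, ?_⟩
  · rw [starHom_quotGrading_eq_top hI (K.graded i)]
    trivial
  · exact Submodule.linearMap_qext _ <| LinearMap.ext_ring <| hK _ (apply_one_mem_torsionBySet f)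

variable (hI : IsGradedSubmodule 𝒜 I)
  (hK : ∀ i, ∀ x ∈ Submodule.torsionBySet R (K.obj i) (I : Set R), K.d i x = 0)

/-- The isomorphism `*Ext^i(R/I, N) ≃ (0 : I)` in `K^i`, for a *injective resolution `K` of `N`
whose differentials vanish on the elements annihilated by the graded ideal `I`. -/
def equivTorsionBySet (i : ℕ) :
    StarExt (quotGrading 𝒜 I) K i ≃ₗ[R] Submodule.torsionBySet R (K.obj i) (I : Set R) :=
  Submodule.quotEquivOfEqBot _ (by
    rw [starCoboundaries_quotGrading_eq_bot hK, Submodule.submoduleOf, Submodule.comap_bot,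
      Submodule.ker_subtype]) ≪≫ₗ
  LinearEquiv.ofTop _ (starCocycles_quotGrading_eq_top hI (hK i)) ≪≫ₗ
  quotHomEquivTorsion I (K.obj i)

theorem equivTorsionBySet_mem_iff {i : ℕ} {g : G} {x : StarExt (quotGrading 𝒜 I) K i} :
    (equivTorsionBySet hI hK i x : K.obj i) ∈ K.grading i g ↔
      x ∈ StarExt.grading (quotGrading 𝒜 I) K i g := by
  refine ⟨fun hx => ?_, ?_⟩
  · obtain ⟨z, rfl⟩ := mk_surjective i x
    exact ⟨z, (mem_starHomDeg_quotGrading_iff (K.graded i)).mpr hx, rfl⟩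
  · rintro ⟨z, hz, rfl⟩
    exact (mem_starHomDeg_quotGrading_iff (K.graded i)).mp hz

theorem exists_equiv_torsionBySet (hI : IsGradedSubmodule 𝒜 I)
    (hK : ∀ i, ∀ x ∈ Submodule.torsionBySet R (K.obj i) (I : Set R), K.d i x = 0)
    (hN : IsGradedModule 𝒜 𝒩) (J : StarInjectiveResolution 𝒜 𝒩) (i : ℕ) :
    ∃ Ψ : StarExt (quotGrading 𝒜 I) J i ≃ₗ[R] Submodule.torsionBySet R (K.obj i) (I : Set R),
      ∀ g x, (Ψ x : K.obj i) ∈ K.grading i g ↔ x ∈ StarExt.grading (quotGrading 𝒜 I) J i g := by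
  obtain ⟨Θ, hΘ, hΘ_symm⟩ := exists_equiv hN (quotGrading 𝒜 I) J K i
  refine ⟨Θ ≪≫ₗ equivTorsionBySet hI hK i, fun g x => ?_⟩
  rw [LinearEquiv.trans_apply, equivTorsionBySet_mem_iff]
  exact ⟨fun hx => Θ.symm_apply_apply x ▸ hΘ_symm.mem hx, fun hx => hΘ.mem hx⟩

end StarExt

end Torsion

section Essential

variable {G : Type*} [AddCommGroup G] [DecidableEq G] {R : Type u} [CommRing R]
variable {𝒜 : G → AddSubgroup R} [GradedRing 𝒜]
variable {M : Type u} [AddCommGroup M] [Module R M] {ℳ : G → AddSubgroup M}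

theorem IsStarEssential.exists_smul_mem {L : Submodule R M} (hess : IsStarEssential ℳ L)
    (hM : IsGradedModule 𝒜 ℳ) (hL : IsGradedSubmodule ℳ L) {g : G} {y : M} (hy : y ∈ ℳ g)
    (hy0 : y ≠ 0) : ∃ k, ∃ c ∈ 𝒜 k, c • y ∈ L ∧ c • y ≠ 0 := by
  have span_inf_ne_bot := hess (Submodule.span R {y}) (isGradedSubmodule_span_singleton hM hy)
    (mt Submodule.span_singleton_eq_bot.mp hy0)
  obtain ⟨_, ⟨hspan, haL⟩, ha0⟩ := Submodule.exists_mem_ne_zero_of_ne_bot span_inf_ne_bot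
  obtain ⟨a, rfl⟩ := Submodule.mem_span_singleton.mp hspan
  obtain ⟨k, hk0⟩ : ∃ k, proj hM.isInternal k (a • y) ≠ 0 := by
    by_contra! hzero
    exact ha0 (eq_zero_of_forall_proj_eq_zero hM.isInternal hzero)
  obtain ⟨c, hc, hck⟩ := hM.exists_proj_smul_eq_smul hy a k
  exact ⟨k - g, c, hc, hck ▸ hL.proj_mem hM.isInternal haL k, hck ▸ hk0⟩

theorem StarInjectiveResolution.IsMinimal.exists_smul_mem_ker_d {I : StarInjectiveResolution 𝒜 ℳ}
    (hI : I.IsMinimal) (hM : IsGradedModule 𝒜 ℳ) {i : ℕ} {g : G} {y : I.obj i}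
    (hy : y ∈ I.grading i g) (hy0 : y ≠ 0) : ∃ k, ∃ c ∈ 𝒜 k, I.d i (c • y) = 0 ∧ c • y ≠ 0 := by
  cases i with
  | zero =>
    obtain ⟨k, c, hc, ⟨z, hz⟩, hcy⟩ := hI.essential_zero.exists_smul_mem (I.graded 0)
      (I.homog_ι.isGradedSubmodule_range hM.isInternal (I.graded 0).isInternal) hy hy0
    exact ⟨k, c, hc, hz ▸ I.exact_zero.apply_apply_eq_zero z, hcy⟩
  | succ i =>
    obtain ⟨k, c, hc, ⟨z, hz⟩, hcy⟩ := (hI.essential_succ i).exists_smul_mem (I.graded (i + 1))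
      ((I.homog_d i).isGradedSubmodule_range (I.graded i).isInternal (I.graded (i + 1)).isInternal)
      hy hy0
    exact ⟨k, c, hc, hz ▸ (I.exact_succ i).apply_apply_eq_zero z, hcy⟩

end Essential

section Localization

variable {G : Type*} [AddCommGroup G] {R : Type*} [CommRing R]
variable {𝒜 : G → AddSubgroup R} {p : Ideal R} [p.IsPrime]
variable {M : Type*} [AddCommGroup M] [Module R M] {ℳ : G → AddSubgroup M}
variable {N : Type*} [AddCommGroup N] [Module R N] {𝒩 : G → AddSubgroup N}

theorem localizedModule_mk_eq_zero_iff {S : Submonoid R} {m : M} {s : S} :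
    LocalizedModule.mk m s = 0 ↔ ∃ t : S, (t : R) • m = 0 := by
  rw [IsLocalizedModule.mk_eq_mk', IsLocalizedModule.mk'_eq_zero']
  rfl

section GradedMonoid

variable [SetLike.GradedMonoid 𝒜]

theorem homogCompl.exists_degree (s : homogCompl 𝒜 p) : ∃ k, (s : R) ∈ 𝒜 k :=
  s.2.1

theorem algebraMap_mem_locGrading {g : G} {a : R} (ha : a ∈ 𝒜 g) :
    algebraMap R (HomogLoc 𝒜 p) a ∈ locGrading 𝒜 p g :=
  ⟨0, a, 1, by rwa [add_zero], SetLike.GradedOne.one_mem, rfl⟩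

variable [SetLike.GradedSMul 𝒜 ℳ] [SetLike.GradedSMul 𝒜 𝒩]

theorem mk_mem_locModuleGrading {g k : G} {m : M} {s : homogCompl 𝒜 p} (hm : m ∈ ℳ (g + k))
    (hs : (s : R) ∈ 𝒜 k) :
    (LocalizedModule.mk m s : HomogLocModule 𝒜 p M) ∈ locModuleGrading 𝒜 p ℳ g :=
  ⟨k, m, s, hm, hs, rfl⟩

theorem isHomog_mkLinearMap :
    IsHomog ℳ (locModuleGrading 𝒜 p ℳ) (LocalizedModule.mkLinearMap (homogCompl 𝒜 p) M) :=
  isHomog_iff.mpr fun _ _ hm =>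
    mk_mem_locModuleGrading (k := 0) (by rwa [add_zero]) SetLike.GradedOne.one_mem

theorem IsHomog.localized (p : Ideal R) [p.IsPrime] {f : M →ₗ[R] N} (hf : IsHomog ℳ 𝒩 f) :
    IsHomog (locModuleGrading 𝒜 p ℳ) (locModuleGrading 𝒜 p 𝒩)
      (LocalizedModule.map (homogCompl 𝒜 p) f) := by
  rw [isHomog_iff]
  rintro g _ ⟨k, m, s, hm, hs, rfl⟩
  rw [LocalizedModule.map_mk]
  exact mk_mem_locModuleGrading (hf.mem hm) hs

variable [DecidableEq G]

theorem IsGradedModule.exists_common_denominator (hM : IsGradedModule 𝒜 ℳ)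
    (x : ⨁ g, locModuleGrading 𝒜 p ℳ g) :
    ∃ (k : G) (s : homogCompl 𝒜 p) (m : M), (s : R) ∈ 𝒜 k ∧
      DirectSum.coeAddMonoidHom _ x = LocalizedModule.mk m s ∧
      ∀ g, (x g : HomogLocModule 𝒜 p M) =
        LocalizedModule.mk (proj hM.isInternal (g + k) m) s := by
  induction x using DirectSum.induction_on with
  | zero => exact ⟨0, 1, 0, SetLike.GradedOne.one_mem, by simp, fun g => by simp⟩
  | of g x =>
    obtain ⟨_, k, m, s, hm, hs, rfl⟩ := x
    refine ⟨k, s, m, hs, DirectSum.coeAddMonoidHom_of _ _ _, fun g' => ?_⟩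
    obtain rfl | hg := eq_or_ne g g'
    · rw [DirectSum.of_eq_same, proj_of_mem _ hm]
    · rw [DirectSum.of_eq_of_ne _ _ _ hg.symm, proj_of_mem_ne _ hm (mt add_right_cancel hg),
        LocalizedModule.zero_mk, ZeroMemClass.coe_zero]
  | add x y hx hy =>
    obtain ⟨k, s, m, hs, hxm, hxg⟩ := hx
    obtain ⟨k', s', m', hs', hym, hyg⟩ := hy
    refine ⟨k + k', s * s', s' • m + s • m', SetLike.GradedMul.mul_mem hs hs', ?_, fun g => ?_⟩
    · rw [map_add, hxm, hym, LocalizedModule.mk_add_mk]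
    · have proj_s'm : proj hM.isInternal (g + (k + k')) (s' • m) =
          s' • proj hM.isInternal (g + k) m := by
        rw [← add_assoc]
        exact hM.proj_smul hs' _ m
      have proj_sm' : proj hM.isInternal (g + (k + k')) (s • m') =
          s • proj hM.isInternal (g + k') m' := by
        rw [add_comm k, ← add_assoc]
        exact hM.proj_smul hs _ m'
      rw [DirectSum.add_apply, AddMemClass.coe_add, hxg, hyg, LocalizedModule.mk_add_mk, map_add,
        proj_s'm, proj_sm']

theorem IsGradedModule.iSup_locModuleGrading (hM : IsGradedModule 𝒜 ℳ) :
    ⨆ g, locModuleGrading 𝒜 p ℳ g = ⊤ := by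
  refine eq_top_iff.mpr fun x _ => ?_
  induction x using LocalizedModule.induction_on with | h m s => ?_
  obtain ⟨k, hk⟩ := homogCompl.exists_degree s
  refine homogeneous_induction hM.isInternal
    (P := fun m => LocalizedModule.mk m s ∈ ⨆ g, locModuleGrading 𝒜 p ℳ g) ?_ ?_ ?_ m
  · rw [LocalizedModule.zero_mk]
    exact zero_mem _
  · intro x y hx hy
    rw [IsLocalizedModule.mk_eq_mk', IsLocalizedModule.mk'_add, ← IsLocalizedModule.mk_eq_mk',
      ← IsLocalizedModule.mk_eq_mk']
    exact add_mem hx hy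
  · intro g x hx
    exact AddSubgroup.mem_iSup_of_mem (g - k)
      (mk_mem_locModuleGrading (by rwa [sub_add_cancel]) hk)

theorem IsGradedModule.isInternal_locModuleGrading (hM : IsGradedModule 𝒜 ℳ) :
    IsInternal (locModuleGrading 𝒜 p ℳ) := by
  refine ⟨(injective_iff_map_eq_zero _).mpr fun x hx => ?_,
    coeAddMonoidHom_surjective_of_iSup_eq_top hM.iSup_locModuleGrading⟩
  obtain ⟨k, s, m, -, hxm, hxg⟩ := hM.exists_common_denominator x
  obtain ⟨t, ht⟩ := localizedModule_mk_eq_zero_iff.mp (hxm.symm.trans hx)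
  obtain ⟨l, hl⟩ := homogCompl.exists_degree t
  refine DFinsupp.ext fun g => Subtype.ext ?_
  rw [hxg]
  refine localizedModule_mk_eq_zero_iff.mpr ⟨t, ?_⟩
  rw [← hM.proj_smul hl, ht, map_zero]

theorem IsGradedModule.localized (p : Ideal R) [p.IsPrime] (hM : IsGradedModule 𝒜 ℳ) :
    IsGradedModule (locGrading 𝒜 p) (locModuleGrading 𝒜 p ℳ) := by
  refine .of_smul_mem hM.isInternal_locModuleGrading ?_
  rintro g k _ _ ⟨l, a, s, ha, hs, rfl⟩ ⟨l', m, t, hm, ht, rfl⟩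
  rw [LocalizedModule.mk_smul_mk]
  refine mk_mem_locModuleGrading (k := l + l') ?_ (SetLike.GradedMul.mul_mem hs ht)
  rw [show k + g + (l + l') = k + l' + (g + l) by abel]
  exact hM.smul_mem ha hm

end GradedMonoid

variable [DecidableEq G] [GradedRing 𝒜]

instance : GradedRing (locGrading 𝒜 p) where
  -- `locGrading 𝒜 p` is definitionally `locModuleGrading 𝒜 p 𝒜`.
  toDecomposition := ((IsGradedModule.self (𝒜 := 𝒜)).localized p).isInternal.chooseDecomposition

theorem isGradedSubmodule_locIdeal (hp : p.IsHomogeneous 𝒜) :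
    IsGradedSubmodule (locGrading 𝒜 p) (locIdeal 𝒜 p) := by
  obtain ⟨S, hS⟩ := (Ideal.IsHomogeneous.iff_exists 𝒜 p).mp hp
  refine isGradedSubmodule_of_isHomogeneous ?_
  have locIdeal_eq_span : locIdeal 𝒜 p =
      Ideal.span (algebraMap R (HomogLoc 𝒜 p) '' (Subtype.val '' S)) :=
    (congrArg (Ideal.map _) hS).trans (Ideal.map_span _ _)
  rw [locIdeal_eq_span]
  refine Ideal.homogeneous_span _ _ ?_
  rintro _ ⟨_, ⟨⟨a, g, ha⟩, -, rfl⟩, rfl⟩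
  exact ⟨g, algebraMap_mem_locGrading ha⟩

end Localization

section LocalizedInjective

variable {G : Type*} [AddCommGroup G] [DecidableEq G] {R : Type u} [CommRing R]
variable {𝒜 : G → AddSubgroup R} [GradedRing 𝒜] {p : Ideal R} [p.IsPrime]
variable {E : Type u} [AddCommGroup E] [Module R E] {ℰ : G → AddSubgroup E}

theorem eq_smul_of_forall_algebraMap (S : Submonoid R) {A : Type*} [CommRing A] [Algebra R A]
    [IsLocalization S A] {N : Type*} [AddCommGroup N] [Module A N] {𝔟 : Ideal A} (f : 𝔟 →ₗ[A] N)
    {e : N} (hf : ∀ (c : R) (hc : algebraMap R A c ∈ 𝔟), f ⟨_, hc⟩ = algebraMap R A c • e) (b : 𝔟) :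
    f b = (b : A) • e := by
  obtain ⟨⟨c, t⟩, hct⟩ := IsLocalization.surj S (b : A)
  have smul_b : algebraMap R A t • b = ⟨algebraMap R A c, hct ▸ 𝔟.mul_mem_right _ b.2⟩ :=
    Subtype.ext ((mul_comm _ _).trans hct)
  rw [← (IsLocalization.map_units A t).smul_left_cancel, ← map_smul, smul_b, hf, smul_smul,
    mul_comm, hct]

theorem exists_homogeneous_lift {B : Type*} [AddCommGroup B] [Module R B]
    [Module.FinitePresentation R B] {ℬ : G → AddSubgroup B} [SetLike.GradedSMul 𝒜 ℰ]
    (hB : IsGradedModule 𝒜 ℬ) (hE : IsGradedModule 𝒜 ℰ) {g : G}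
    {q : B →ₗ[R] HomogLocModule 𝒜 p E} (hq : IsHomogOfDegree ℬ (locModuleGrading 𝒜 p ℰ) g q) :
    ∃ (k : G) (s : homogCompl 𝒜 p) (h : B →ₗ[R] E), (s : R) ∈ 𝒜 k ∧
      IsHomogOfDegree ℬ ℰ (g + k) h ∧ ∀ b, LocalizedModule.mk (h b) 1 = s • q b := by
  obtain ⟨h, s, hs⟩ := Module.FinitePresentation.exists_lift_of_isLocalizedModule
    (homogCompl 𝒜 p) (LocalizedModule.mkLinearMap (homogCompl 𝒜 p) E) q
  obtain ⟨k, hk⟩ := homogCompl.exists_degree s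
  obtain ⟨h', h'_homog, h'_eq⟩ := exists_linearMap_homogeneous_component hB hE h (g + k)
  have hEp := (hE.localized p).isInternal
  have sq_mem (l : G) (b : B) (hb : b ∈ ℬ l) :
      s • q b ∈ locModuleGrading 𝒜 p ℰ (l + (g + k)) := by
    rw [← add_assoc]
    exact algebraMap_smul (HomogLoc 𝒜 p) (s : R) (q b) ▸
      (hE.localized p).smul_mem (algebraMap_mem_locGrading hk) (hq l b hb)
  refine ⟨k, s, h', hk, h'_homog, fun b => ?_⟩
  change LocalizedModule.mkLinearMap (homogCompl 𝒜 p) E (h' b) = s • q b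
  refine homogeneous_induction hB.isInternal
    (P := fun b => LocalizedModule.mkLinearMap (homogCompl 𝒜 p) E (h' b) = s • q b)
    (by simp) (fun b c hb hc => by simp only [map_add, smul_add, hb, hc]) (fun l b hb => ?_) b
  calc LocalizedModule.mkLinearMap (homogCompl 𝒜 p) E (h' b)
      = proj hEp (l + (g + k)) (LocalizedModule.mkLinearMap (homogCompl 𝒜 p) E (h b)) := by
        rw [h'_eq l b hb, isHomog_mkLinearMap.proj_map hE.isInternal hEp]
    _ = proj hEp (l + (g + k)) (s • q b) := congrArg _ (LinearMap.congr_fun hs b)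
    _ = s • q b := proj_of_mem hEp (sq_mem l b hb)

theorem IsStarBaer.localized [IsNoetherianRing R] [SetLike.GradedSMul 𝒜 ℰ]
    (hBaer : IsStarBaer 𝒜 ℰ) (hE : IsGradedModule 𝒜 ℰ) :
    IsStarBaer (locGrading 𝒜 p) (locModuleGrading 𝒜 p ℰ) := by
  intro 𝔟 h𝔟 g f hf
  let toLoc := Algebra.linearMap R (HomogLoc 𝒜 p)
  let 𝔟₀ : Ideal R := (𝔟.restrictScalars R).comap toLoc
  let q : 𝔟₀ →ₗ[R] HomogLocModule 𝒜 p E :=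
    f.restrictScalars R ∘ₗ toLoc.restrict (q := 𝔟.restrictScalars R) fun _ hb => hb
  have toLoc_homog : IsHomog 𝒜 (locGrading 𝒜 p) toLoc :=
    isHomog_iff.mpr fun _ _ ha => algebraMap_mem_locGrading ha
  have h𝔟₀ : IsGradedSubmodule 𝒜 𝔟₀ := toLoc_homog.isGradedSubmodule_comap
    (Decomposition.isInternal 𝒜) (Decomposition.isInternal (locGrading 𝒜 p)) h𝔟
  have h𝔟₀_graded := IsGradedModule.self.submodule h𝔟₀
  have : Module.FinitePresentation R 𝔟₀ := Module.finitePresentation_of_finite R 𝔟₀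
  obtain ⟨k, s, h, hs, h_homog, h_eq⟩ := exists_homogeneous_lift (p := p) h𝔟₀_graded hE
    (q := q) (g := g) fun l b hb => hf l _ (toLoc_homog.mem hb)
  obtain ⟨e, he, h_apply⟩ := hBaer 𝔟₀ h𝔟₀ (g + k) h h_homog
  refine ⟨LocalizedModule.mk e s, mk_mem_locModuleGrading he hs,
    eq_smul_of_forall_algebraMap (homogCompl 𝒜 p) f fun c hc => ?_⟩
  refine IsLocalizedModule.smul_injective
    (LocalizedModule.mkLinearMap (homogCompl 𝒜 p) E) s ?_
  calc s • q ⟨c, hc⟩ = LocalizedModule.mk (c • e) 1 := by rw [← h_eq, h_apply]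
    _ = c • LocalizedModule.mk (s • e) s := by
      rw [LocalizedModule.mk_cancel, LocalizedModule.smul'_mk]
    _ = c • s • LocalizedModule.mk e s :=
      congrArg (c • ·) (LocalizedModule.smul'_mk (s : R) e s).symm
    _ = s • algebraMap R (HomogLoc 𝒜 p) c • LocalizedModule.mk e s := by
      rw [algebraMap_smul, smul_comm]

theorem IsStarInjective.localized [IsNoetherianRing R] [SetLike.GradedSMul 𝒜 ℰ]
    (p : Ideal R) [p.IsPrime] (hinj : IsStarInjective 𝒜 ℰ) (hE : IsGradedModule 𝒜 ℰ) :
    IsStarInjective (locGrading 𝒜 p) (locModuleGrading 𝒜 p ℰ) :=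
  (hinj.isStarBaer.localized hE).isStarInjective (hE.localized p)

end LocalizedInjective

section LocalizedResolution

variable {G : Type*} [AddCommGroup G] {R : Type u} [CommRing R]
variable {𝒜 : G → AddSubgroup R} {p : Ideal R} [p.IsPrime]
variable {M : Type u} [AddCommGroup M] [Module R M] {ℳ : G → AddSubgroup M}

instance StarInjectiveResolution.gradedSMul [DecidableEq G] (I : StarInjectiveResolution 𝒜 ℳ)
    (i : ℕ) : SetLike.GradedSMul 𝒜 (I.grading i) :=
  (I.graded i).gradedSMul

variable [IsNoetherianRing R]

theorem exists_mk_of_mem_torsionBySet [SetLike.GradedMonoid 𝒜] [SetLike.GradedSMul 𝒜 ℳ] {g : G}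
    {x : HomogLocModule 𝒜 p M} (hx : x ∈ locModuleGrading 𝒜 p ℳ g)
    (hpx : x ∈ Submodule.torsionBySet (HomogLoc 𝒜 p) (HomogLocModule 𝒜 p M)
      (locIdeal 𝒜 p : Set (HomogLoc 𝒜 p))) :
    ∃ (k : G) (y : M) (s : homogCompl 𝒜 p), y ∈ ℳ (g + k) ∧ (s : R) ∈ 𝒜 k ∧
      x = LocalizedModule.mk y s ∧ y ∈ Submodule.torsionBySet R M p := by
  obtain ⟨k, m, s, hm, hs, rfl⟩ := hx
  have mk_smul_eq_zero (a : p) : LocalizedModule.mk ((a : R) • m) s = 0 := by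
    rw [← LocalizedModule.smul'_mk, ← algebraMap_smul (HomogLoc 𝒜 p)]
    exact (Submodule.mem_torsionBySet_iff _ _).mp hpx ⟨_, Ideal.mem_map_of_mem _ a.2⟩
  obtain ⟨t, ht⟩ := Module.Finite.exists_smul_of_comp_eq_of_isLocalizedModule (homogCompl 𝒜 p)
    (LocalizedModule.mkLinearMap (homogCompl 𝒜 p) M)
    (LinearMap.toSpanSingleton R M m ∘ₗ p.subtype) 0 <| LinearMap.ext fun a => by
      rw [LinearMap.comp_zero]
      exact localizedModule_mk_eq_zero_iff.mpr
        (localizedModule_mk_eq_zero_iff.mp (mk_smul_eq_zero a))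
  obtain ⟨l, hl⟩ := homogCompl.exists_degree t
  refine ⟨l + k, (t : R) • m, t * s, ?_, SetLike.GradedMul.mul_mem hl hs,
    (LocalizedModule.mk_cancel_common_left t s m).symm,
    (Submodule.mem_torsionBySet_iff _ _).mpr fun a => ?_⟩
  · rw [add_left_comm]
    exact SetLike.GradedSMul.smul_mem hl hm
  · rw [smul_comm]
    exact (LinearMap.congr_fun ht a).trans (smul_zero t)

variable [DecidableEq G] [GradedRing 𝒜] [SetLike.GradedSMul 𝒜 ℳ]

/-- The homogeneous localization at `p` of a *injective resolution, which is again a *injective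
resolution because `R` is Noetherian. -/
def StarInjectiveResolution.localized (I : StarInjectiveResolution 𝒜 ℳ) (p : Ideal R)
    [p.IsPrime] : StarInjectiveResolution (locGrading 𝒜 p) (locModuleGrading 𝒜 p ℳ) where
  obj i := HomogLocModule 𝒜 p (I.obj i)
  grading i := locModuleGrading 𝒜 p (I.grading i)
  graded i := (I.graded i).localized p
  injective i := (I.injective i).localized p (I.graded i)
  ι := LocalizedModule.map (homogCompl 𝒜 p) I.ι
  d i := LocalizedModule.map (homogCompl 𝒜 p) (I.d i)
  homog_ι := I.homog_ι.localized p
  homog_d i := (I.homog_d i).localized p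
  mono_ι := LocalizedModule.map_injective (homogCompl 𝒜 p) I.ι I.mono_ι
  exact_zero := LocalizedModule.map_exact (homogCompl 𝒜 p) _ _ I.exact_zero
  exact_succ i := LocalizedModule.map_exact (homogCompl 𝒜 p) _ _ (I.exact_succ i)

theorem StarInjectiveResolution.IsMinimal.localized_d_eq_zero_of_mem_grading
    {I : StarInjectiveResolution 𝒜 ℳ} (hI : I.IsMinimal) (hM : IsGradedModule 𝒜 ℳ) {i : ℕ}
    {g : G} {x : (I.localized p).obj i} (hx : x ∈ (I.localized p).grading i g)
    (hpx : x ∈ Submodule.torsionBySet (HomogLoc 𝒜 p) ((I.localized p).obj i)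
      (locIdeal 𝒜 p : Set (HomogLoc 𝒜 p))) : (I.localized p).d i x = 0 := by
  obtain ⟨k, y, s, hy, -, rfl, hpy⟩ := exists_mk_of_mem_torsionBySet hx hpx
  refine (LocalizedModule.map_mk _ _ _ _).trans ?_
  obtain rfl | hy0 := eq_or_ne y 0
  · rw [map_zero, LocalizedModule.zero_mk]
    rfl
  obtain ⟨l, c, hc, hdc, hcy⟩ := hI.exists_smul_mem_ker_d hM hy hy0
  have c_notMem : c ∉ p := fun hcp => hcy ((Submodule.mem_torsionBySet_iff _ _).mp hpy ⟨c, hcp⟩)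
  exact localizedModule_mk_eq_zero_iff.mpr ⟨⟨c, ⟨l, hc⟩, c_notMem⟩, by rw [← map_smul, hdc]⟩

theorem StarInjectiveResolution.IsMinimal.localized_d_eq_zero {I : StarInjectiveResolution 𝒜 ℳ}
    (hI : I.IsMinimal) (hM : IsGradedModule 𝒜 ℳ) (hp : p.IsHomogeneous 𝒜) {i : ℕ}
    {x : (I.localized p).obj i}
    (hpx : x ∈ Submodule.torsionBySet (HomogLoc 𝒜 p) ((I.localized p).obj i)
      (locIdeal 𝒜 p : Set (HomogLoc 𝒜 p))) : (I.localized p).d i x = 0 := by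
  have h_graded := (I.localized p).graded i
  obtain ⟨t, ht⟩ := exists_sum_proj_eq h_graded.isInternal x
  rw [← ht, map_sum]
  refine Finset.sum_eq_zero fun g _ =>
    hI.localized_d_eq_zero_of_mem_grading hM (proj_mem h_graded.isInternal g x) ?_
  exact (isGradedSubmodule_torsionBySet h_graded (isGradedSubmodule_locIdeal hp)).proj_mem
    h_graded.isInternal hpx g

end LocalizedResolution

section Envelope

variable {G : Type*} [AddCommGroup G] [DecidableEq G] {R : Type u} [CommRing R]
variable {𝒜 : G → AddSubgroup R} {q : Ideal R}
variable {E : Type u} [AddCommGroup E] [Module R E] {ℰ : G → AddSubgroup E}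
variable {e : (R ⧸ q) →ₗ[R] E}

theorem range_linearMap_quotient_eq_span (e : (R ⧸ q) →ₗ[R] E) :
    LinearMap.range e = Submodule.span R {e 1} := by
  ext x
  rw [LinearMap.mem_range, Ideal.Quotient.mk_surjective.exists, Submodule.mem_span_singleton]
  simp only [linearMap_quotient_apply_mk]

namespace IsStarInjectiveEnvelope

theorem smul_map_one_eq_zero_iff (he : IsStarInjectiveEnvelope 𝒜 (quotGrading 𝒜 q) ℰ e) {r : R} :
    r • e 1 = 0 ↔ r ∈ q := by
  rw [← linearMap_quotient_apply_mk, map_eq_zero_iff e he.mono, Ideal.Quotient.eq_zero_iff_mem]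

variable [GradedRing 𝒜]

theorem map_one_mem (he : IsStarInjectiveEnvelope 𝒜 (quotGrading 𝒜 q) ℰ e) : e 1 ∈ ℰ 0 :=
  he.homog.mem SetLike.GradedOne.one_mem

theorem exists_smul_eq (he : IsStarInjectiveEnvelope 𝒜 (quotGrading 𝒜 q) ℰ e) {g : G} {y : E}
    (hy : y ∈ ℰ g) (hy0 : y ≠ 0) :
    ∃ k, ∃ c ∈ 𝒜 k, ∃ r ∈ 𝒜 (g + k), c • y = r • e 1 ∧ c • y ≠ 0 := by
  have essential := he.essential
  rw [range_linearMap_quotient_eq_span] at essential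
  obtain ⟨k, c, hc, hcy, hcy0⟩ := essential.exists_smul_mem he.graded
    (isGradedSubmodule_span_singleton he.graded he.map_one_mem) hy hy0
  obtain ⟨r, hr⟩ := Submodule.mem_span_singleton.mp hcy
  obtain ⟨r', hr', proj_eq⟩ := he.graded.exists_proj_smul_eq_smul he.map_one_mem r (g + k)
  rw [hr, proj_of_mem _ (he.graded.smul_mem hc hy)] at proj_eq
  exact ⟨k, c, hc, r', by rwa [sub_zero] at hr', proj_eq, hcy0⟩

-- The annihilators of the elements `s ^ n • y` form an ascending chain.
theorem exists_pow_smul_eq_zero [IsNoetherianRing R]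
    (he : IsStarInjectiveEnvelope 𝒜 (quotGrading 𝒜 q) ℰ e) {g k : G} {y : E} (hy : y ∈ ℰ g)
    {s : R} (hs : s ∈ 𝒜 k) (hsq : s ∈ q) : ∃ n : ℕ, s ^ n • y = 0 := by
  let ann (n : ℕ) : Ideal R := LinearMap.ker (LinearMap.toSpanSingleton R E (s ^ n • y))
  have mem_ann {n : ℕ} {c : R} : c ∈ ann n ↔ c • s ^ n • y = 0 := Iff.rfl
  have ann_mono : Monotone ann := monotone_nat_of_le_succ fun n c hc => by
    rw [mem_ann, pow_succ', mul_smul, smul_comm, mem_ann.mp hc, smul_zero]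
  obtain ⟨n, stable⟩ := monotone_stabilizes_iff_noetherian.mpr ‹IsNoetherianRing R› ⟨ann, ann_mono⟩
  refine ⟨n, by_contra fun ne_zero => ?_⟩
  obtain ⟨l, c, -, r, -, hcr, hc0⟩ := he.exists_smul_eq
    (he.graded.smul_mem (SetLike.pow_mem_graded n hs) hy) ne_zero
  have c_mem : c ∈ ann (n + 1) := by
    rw [mem_ann, pow_succ', mul_smul, smul_comm, hcr, smul_smul, he.smul_map_one_eq_zero_iff]
    exact q.mul_mem_right r hsq
  exact hc0 (mem_ann.mp ((stable (n + 1) n.le_succ).ge c_mem))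

theorem le_of_mem_torsionBySet (he : IsStarInjectiveEnvelope 𝒜 (quotGrading 𝒜 q) ℰ e)
    (hq : q.IsPrime) {p : Ideal R} {g : G} {y : E} (hy : y ∈ ℰ g) (hy0 : y ≠ 0)
    (hpy : y ∈ Submodule.torsionBySet R E p) : p ≤ q := by
  obtain ⟨k, c, -, r, -, hcr, hc0⟩ := he.exists_smul_eq hy hy0
  have r_notMem : r ∉ q := fun hr => hc0 (hcr.trans (he.smul_map_one_eq_zero_iff.mpr hr))
  refine fun a ha => (hq.mem_or_mem (he.smul_map_one_eq_zero_iff.mp ?_)).resolve_right r_notMem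
  rw [mul_smul, ← hcr, smul_comm, (Submodule.mem_torsionBySet_iff _ _).mp hpy ⟨a, ha⟩, smul_zero]

theorem exists_smul_eq_zero_of_ne [IsNoetherianRing R]
    (he : IsStarInjectiveEnvelope 𝒜 (quotGrading 𝒜 q) ℰ e) (hq : q.IsPrime)
    (hq_graded : q.IsHomogeneous 𝒜) {p : Ideal R} [p.IsPrime] (hqp : q ≠ p) {g : G} {y : E}
    (hy : y ∈ ℰ g) (hpy : y ∈ Submodule.torsionBySet R E p) :
    ∃ k, ∃ c ∈ 𝒜 k, c ∉ p ∧ c • y = 0 := by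
  obtain rfl | hy0 := eq_or_ne y 0
  · exact ⟨0, 1, SetLike.GradedOne.one_mem, p.one_notMem, smul_zero 1⟩
  obtain ⟨l, s, hs, hsq, hsp⟩ : ∃ l, ∃ s ∈ 𝒜 l, s ∈ q ∧ s ∉ p := by
    by_contra! homogeneous_mem
    refine hqp (le_antisymm (fun x hx => ?_) (he.le_of_mem_torsionBySet hq hy hy0 hpy))
    classical
    rw [← DirectSum.sum_support_decompose 𝒜 x]
    exact sum_mem fun l _ => homogeneous_mem l _ (SetLike.coe_mem _) (hq_graded l hx)
  obtain ⟨n, hn⟩ := he.exists_pow_smul_eq_zero hy hs hsq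
  exact ⟨n • l, s ^ n, SetLike.pow_mem_graded n hs, mt (Ideal.IsPrime.mem_of_pow_mem ‹_› n) hsp, hn⟩

theorem exists_smul_eq_of_mem_torsionBySet [IsNoetherianRing R]
    (he : IsStarInjectiveEnvelope 𝒜 (quotGrading 𝒜 q) ℰ e) (hq : q.IsPrime)
    (hq_graded : q.IsHomogeneous 𝒜) {p : Ideal R} [p.IsPrime] {g : G} {y : E} (hy : y ∈ ℰ g)
    (hpy : y ∈ Submodule.torsionBySet R E p) :
    ∃ k, ∃ c ∈ 𝒜 k, c ∉ p ∧ ∃ r ∈ 𝒜 (g + k), c • y = r • e 1 ∧ (q ≠ p → r = 0) := by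
  by_cases hy_or : q ≠ p ∨ y = 0
  · obtain ⟨k, c, hc, hcp, hcy⟩ : ∃ k, ∃ c ∈ 𝒜 k, c ∉ p ∧ c • y = 0 := hy_or.elim
      (fun hqp => he.exists_smul_eq_zero_of_ne hq hq_graded hqp hy hpy)
      (fun hy0 => ⟨0, 1, SetLike.GradedOne.one_mem, p.one_notMem, by rw [hy0, smul_zero]⟩)
    exact ⟨k, c, hc, hcp, 0, zero_mem _, by rw [hcy, zero_smul], fun _ => rfl⟩
  · obtain ⟨hqp, hy0⟩ := not_or.mp hy_or
    obtain ⟨k, c, hc, r, hr, hcr, hc0⟩ := he.exists_smul_eq hy hy0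
    exact ⟨k, c, hc, fun hcp => hc0 ((Submodule.mem_torsionBySet_iff _ _).mp hpy ⟨c, hcp⟩),
      r, hr, hcr, fun h => absurd h hqp⟩

end IsStarInjectiveEnvelope

end Envelope

section DirectSums

variable {G : Type*} {Λ : Type*} {X : Λ → Type*} [∀ α, AddCommGroup (X α)]
variable {𝒳 : ∀ α, G → AddSubgroup (X α)}

theorem of_mem_directSumGrading [DecidableEq Λ] {g : G} {α : Λ} {x : X α}
    (hx : x ∈ 𝒳 α g) : DirectSum.of X α x ∈ directSumGrading 𝒳 g := by
  intro β
  obtain rfl | hβ := eq_or_ne β α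
  · rwa [DirectSum.of_eq_same]
  · rw [DirectSum.of_eq_of_ne _ _ _ hβ]
    exact zero_mem _

theorem iSup_directSumGrading_eq_top (h : ∀ α, ⨆ g, 𝒳 α g = ⊤) :
    ⨆ g, directSumGrading 𝒳 g = ⊤ := by
  classical
  refine eq_top_iff.mpr fun x _ => ?_
  induction x using DirectSum.induction_on with
  | zero => exact zero_mem _
  | add x y hx hy => exact add_mem (hx trivial) (hy trivial)
  | of α x =>
    have le_comap : ⨆ g, 𝒳 α g ≤ (⨆ g, directSumGrading 𝒳 g).comap (DirectSum.of X α) :=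
      iSup_le fun g x hx => AddSubgroup.mem_iSup_of_mem g (of_mem_directSumGrading hx)
    exact le_comap (h α ▸ AddSubgroup.mem_top x)

theorem isInternal_directSumGrading [DecidableEq G]
    (h : ∀ α, IsInternal (𝒳 α)) : IsInternal (directSumGrading 𝒳) := by
  refine isInternal_of_iSup_eq_top_of_proj
    (iSup_directSumGrading_eq_top fun α => iSup_eq_top_of_isInternal (h α))
    (fun g => DirectSum.map fun α => proj (h α) g) (fun g x hx => DFinsupp.ext fun α => ?_)
    (fun g k hkg x hx => DFinsupp.ext fun α => ?_)
  · rw [DirectSum.map_apply, proj_of_mem _ (hx α)]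
  · rw [DirectSum.map_apply, proj_of_mem_ne _ (hx α) hkg, DirectSum.zero_apply]

end DirectSums

section Regrade

variable {G : Type*} [AddCommGroup G] {H : Type*} [AddCommGroup H]
variable {M : Type*} [AddCommGroup M] {ℳ : G → AddSubgroup M}

theorem mem_regrade {φ : G →+ H} {g : G} {h : H} (hg : φ g = h) {x : M} (hx : x ∈ ℳ g) :
    x ∈ regrade φ ℳ h :=
  AddSubgroup.mem_iSup_of_mem (S := fun k : {k // φ k = h} => ℳ k) ⟨g, hg⟩ hx

end Regrade

section HomogeneousBasis

variable {G : Type*} [AddCommGroup G] {T : Type*} [CommRing T] {𝒯 : G → AddSubgroup T}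
variable {ι W : Type u} [AddCommGroup W] [Module T W] {𝒲 : G → AddSubgroup W}
variable {n : ι → G} {w : ι → W}

/-- The homogeneous elements `w x`, of degree `n x`, form a basis of the graded `T`-module `W`.
The spanning condition asks for homogeneous coefficients, so that it can be read off in each degree
separately. -/
structure IsHomogeneousBasis (𝒯 : G → AddSubgroup T) (𝒲 : G → AddSubgroup W) (n : ι → G)
    (w : ι → W) : Prop where
  linearIndependent : LinearIndependent T w
  mem : ∀ x, w x ∈ 𝒲 (n x)
  exists_sum_eq : ∀ g, ∀ y ∈ 𝒲 g, ∃ (s : Finset ι) (t : ι → T),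
    (∀ x, t x ∈ 𝒯 (g - n x)) ∧ ∑ x ∈ s, t x • w x = y

namespace IsHomogeneousBasis

theorem map (hw : IsHomogeneousBasis 𝒯 𝒲 n w) {V : Type u} [AddCommGroup V] [Module T V]
    {𝒱 : G → AddSubgroup V} (Φ : W ≃ₗ[T] V) (hΦ : ∀ g x, Φ x ∈ 𝒱 g ↔ x ∈ 𝒲 g) :
    IsHomogeneousBasis 𝒯 𝒱 n (Φ ∘ w) where
  linearIndependent := hw.linearIndependent.map' Φ.toLinearMap Φ.ker
  mem x := (hΦ _ _).mpr (hw.mem x)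
  exists_sum_eq g y hy := by
    obtain ⟨s, t, ht, hsum⟩ := hw.exists_sum_eq g (Φ.symm y)
      ((hΦ _ _).mp (by rwa [Φ.apply_symm_apply]))
    refine ⟨s, t, ht, ?_⟩
    simp only [Function.comp_apply, ← map_smul, ← map_sum, hsum, Φ.apply_symm_apply]

variable [SetLike.GradedMonoid 𝒯] {H : Type*} [AddCommGroup H] {φ : G →+ H} {a : H}
variable {P : Submodule (SetLike.GradeZero.subring (regrade φ 𝒯)) W}

theorem eq_span_of_mem_iff_mem_regrade (hw : IsHomogeneousBasis 𝒯 𝒲 n w)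
    (hφ : ∀ g, ∀ t ∈ 𝒯 g, t ≠ 0 → φ g = 0) (hP : ∀ y, y ∈ P ↔ y ∈ regrade φ 𝒲 a) :
    P = Submodule.span _ (Set.range fun x : {x // φ (n x) = a} => w x) := by
  refine le_antisymm (fun y hy => ?_) (Submodule.span_le.mpr ?_)
  · refine iSup_le (a := AddSubgroup.ofClass
      (Submodule.span _ (Set.range fun x : {x // φ (n x) = a} => w x))) ?_ ((hP y).mp hy)
    rintro ⟨g, rfl⟩ y hy
    obtain ⟨s, t, ht, rfl⟩ := hw.exists_sum_eq g y hy
    refine sum_mem fun x _ => ?_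
    obtain ht0 | ht0 := eq_or_ne (t x) 0
    · rw [ht0, zero_smul]
      exact zero_mem _
    · have φ_sub := hφ _ _ (ht x) ht0
      have hx : φ (n x) = φ g := (sub_eq_zero.mp (by rwa [← map_sub])).symm
      let t₀ : SetLike.GradeZero.subring (regrade φ 𝒯) := ⟨t x, mem_regrade φ_sub (ht x)⟩
      exact Submodule.smul_mem _ t₀ (Submodule.subset_span ⟨⟨x, hx⟩, rfl⟩)
  · rintro _ ⟨⟨x, rfl⟩, rfl⟩
    exact (hP _).mpr (mem_regrade rfl (hw.mem x))

theorem free_and_mk_eq_rank [Nontrivial T] (hw : IsHomogeneousBasis 𝒯 𝒲 n w)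
    (hφ : ∀ g, ∀ t ∈ 𝒯 g, t ≠ 0 → φ g = 0) (hP : ∀ y, y ∈ P ↔ y ∈ regrade φ 𝒲 a) :
    Module.Free (SetLike.GradeZero.subring (regrade φ 𝒯)) P ∧
      Cardinal.mk {x // φ (n x) = a} =
        Module.rank (SetLike.GradeZero.subring (regrade φ 𝒯)) P := by
  have independent : LinearIndependent (SetLike.GradeZero.subring (regrade φ 𝒯))
      fun x : {x // φ (n x) = a} => w x :=
    LinearIndependent.restrict_scalars' _
      (hw.linearIndependent.comp _ Subtype.val_injective)
  obtain rfl := hw.eq_span_of_mem_iff_mem_regrade hφ hP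
  let basis := Module.Basis.span independent
  exact ⟨.of_basis basis, basis.mk_eq_rank''⟩

end IsHomogeneousBasis

end HomogeneousBasis

theorem localizedModule_mk_sum {R M : Type*} [CommRing R] [AddCommGroup M] [Module R M]
    {S : Submonoid R} {ι : Type*} (s : Finset ι) (f : ι → M) (u : S) :
    LocalizedModule.mk (∑ x ∈ s, f x) u = ∑ x ∈ s, LocalizedModule.mk (f x) u := by
  have mk_eq_divBy (m : M) : LocalizedModule.mk m u =
      LocalizedModule.divBy u (LocalizedModule.mkLinearMap S M m) := by
    rw [LocalizedModule.mkLinearMap_apply, LocalizedModule.divBy_apply,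
      LocalizedModule.liftOn_mk, one_mul]
  simp only [mk_eq_divBy, map_sum]

theorem linearIndependent_quotient {A N : Type*} [CommRing A] [AddCommGroup N] [Module A N]
    {I : Ideal A} [Module (A ⧸ I) N] [IsScalarTower A (A ⧸ I) N] {ι : Type*} {w : ι → N}
    (hw : ∀ (s : Finset ι) (t : ι → A), ∑ x ∈ s, t x • w x = 0 → ∀ x ∈ s, t x ∈ I) :
    LinearIndependent (A ⧸ I) w := by
  refine linearIndependent_iff'.mpr fun s c hc x hx => ?_
  choose t ht using fun x => Ideal.Quotient.mk_surjective (c x)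
  rw [← ht, Ideal.Quotient.eq_zero_iff_mem]
  refine hw s t ?_ x hx
  simpa only [← ht, ← Ideal.Quotient.algebraMap_eq, algebraMap_smul] using hc

section LocalizedIdeal

variable {G : Type*} [AddCommGroup G] {R : Type*} [CommRing R]
variable {𝒜 : G → AddSubgroup R} [SetLike.GradedMonoid 𝒜] {p : Ideal R} [p.IsPrime]
variable {M : Type*} [AddCommGroup M] [Module R M] {m : M}

theorem locIdeal_ne_top (𝒜 : G → AddSubgroup R) [SetLike.GradedMonoid 𝒜] (p : Ideal R)
    [hp : p.IsPrime] : locIdeal 𝒜 p ≠ ⊤ :=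
  (IsLocalization.isPrime_of_isPrime_disjoint (homogCompl 𝒜 p) (HomogLoc 𝒜 p) p hp
    (Set.disjoint_left.mpr fun _ hs => hs.2)).ne_top

theorem mk_mem_locIdeal {r : R} (hr : r ∈ p) (s : homogCompl 𝒜 p) :
    Localization.mk r s ∈ locIdeal 𝒜 p := by
  rw [Localization.mk_eq_mk', IsLocalization.mk'_eq_mul_mk'_one]
  exact Ideal.mul_mem_right _ _ (Ideal.mem_map_of_mem _ hr)

theorem mem_locIdeal_of_smul_mk_eq_zero (hm : ∀ r : R, r • m = 0 → r ∈ p) {t : HomogLoc 𝒜 p}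
    (ht : t • (LocalizedModule.mk m 1 : HomogLocModule 𝒜 p M) = 0) : t ∈ locIdeal 𝒜 p := by
  induction t using Localization.induction_on with | H t => ?_
  obtain ⟨r, s⟩ := t
  rw [LocalizedModule.mk_smul_mk] at ht
  obtain ⟨u, hu⟩ := localizedModule_mk_eq_zero_iff.mp ht
  rw [smul_smul] at hu
  exact mk_mem_locIdeal ((Ideal.IsPrime.mem_or_mem ‹_› (hm _ hu)).resolve_left u.2.2) s

theorem mk_mem_torsionBySet_locIdeal (hm : m ∈ Submodule.torsionBySet R M p)
    (s : homogCompl 𝒜 p) :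
    (LocalizedModule.mk m s : HomogLocModule 𝒜 p M) ∈ Submodule.torsionBySet (HomogLoc 𝒜 p)
      (HomogLocModule 𝒜 p M) (locIdeal 𝒜 p : Set (HomogLoc 𝒜 p)) := by
  have locIdeal_le : locIdeal 𝒜 p ≤ LinearMap.ker (LinearMap.toSpanSingleton (HomogLoc 𝒜 p)
      (HomogLocModule 𝒜 p M) (LocalizedModule.mk m s)) := by
    refine Ideal.map_le_iff_le_comap.mpr fun r hr => ?_
    rw [Ideal.mem_comap, LinearMap.mem_ker, LinearMap.toSpanSingleton_apply, algebraMap_smul,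
      LocalizedModule.smul'_mk, (Submodule.mem_torsionBySet_iff _ _).mp hm ⟨r, hr⟩,
      LocalizedModule.zero_mk]
  exact (Submodule.mem_torsionBySet_iff _ _).mpr fun r => locIdeal_le r.2

end LocalizedIdeal

section SummandGenerators

variable {G : Type*} [AddCommGroup G] [DecidableEq G]
variable {R : Type u} [CommRing R] {𝒜 : G → AddSubgroup R} [GradedRing 𝒜]
variable {D : Type u} [AddCommGroup D] [Module R D] {𝒟 : G → AddSubgroup D}
variable {Λ : Type u} [DecidableEq Λ] {𝔭 : Λ → Ideal R} {n : Λ → G}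
variable {E : Λ → Type u} [∀ α, AddCommGroup (E α)] [∀ α, Module R (E α)]
variable {ℰ : ∀ α, G → AddSubgroup (E α)} {e : ∀ α, (R ⧸ 𝔭 α) →ₗ[R] E α}
variable {θ : D ≃ₗ[R] DirectSum Λ E}

/-- The element of `D ≅ ⨁ *E(R/𝔭_α)(-n_α)` that corresponds to `1 ∈ R/𝔭_α`. -/
def summandGenerator (θ : D ≃ₗ[R] DirectSum Λ E) (e : ∀ α, (R ⧸ 𝔭 α) →ₗ[R] E α) (α : Λ) : D :=
  θ.symm (DirectSum.lof R Λ E α (e α 1))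

theorem map_summandGenerator (α : Λ) :
    θ (summandGenerator θ e α) = DirectSum.lof R Λ E α (e α 1) :=
  θ.apply_symm_apply _

theorem smul_summandGenerator (r : R) (α : Λ) :
    r • summandGenerator θ e α = θ.symm (DirectSum.lof R Λ E α (r • e α 1)) := by
  rw [summandGenerator, map_smul, map_smul]

theorem summandGenerator_mem_torsionBySet (α : Λ) :
    summandGenerator θ e α ∈ Submodule.torsionBySet R D (𝔭 α) := by
  refine (Submodule.mem_torsionBySet_iff _ _).mpr fun r => ?_
  rw [smul_summandGenerator, ← linearMap_quotient_apply_mk,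
    Ideal.Quotient.eq_zero_iff_mem.mpr r.2, map_zero, map_zero, map_zero]

theorem summandGenerator_mem (hD : IsGradedModule 𝒜 𝒟)
    (he : ∀ α, IsStarInjectiveEnvelope 𝒜 (quotGrading 𝒜 (𝔭 α)) (ℰ α) (e α))
    (hθ : IsHomog 𝒟 (directSumGrading fun α => shift (ℰ α) (-n α)) θ.toLinearMap) (α : Λ) :
    summandGenerator θ e α ∈ 𝒟 (n α) := by
  have h_internal := isInternal_directSumGrading fun α => ((he α).graded.shift (-n α)).isInternal
  have map_mem : θ (summandGenerator θ e α) ∈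
      directSumGrading (fun α => shift (ℰ α) (-n α)) (n α) := by
    rw [map_summandGenerator]
    refine of_mem_directSumGrading (𝒳 := fun α => shift (ℰ α) (-n α)) ?_
    rw [shift, add_neg_cancel]
    exact (he α).map_one_mem
  have proj_eq : proj hD.isInternal (n α) (summandGenerator θ e α) = summandGenerator θ e α :=
    θ.injective ((hθ.proj_map hD.isInternal h_internal _ _).symm.trans
      (proj_of_mem h_internal map_mem))
  exact proj_eq ▸ proj_mem _ _ _

variable {p : Ideal R} [p.IsPrime]

/-- The image in `D_(p)` of the generator of a summand `*E(R/p)(-n_α)` of `D`, as an element of the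
part of `D_(p)` annihilated by `p`. -/
def localizedSummandGenerator (𝒜 : G → AddSubgroup R) [GradedRing 𝒜] (θ : D ≃ₗ[R] DirectSum Λ E)
    (e : ∀ α, (R ⧸ 𝔭 α) →ₗ[R] E α) (p : Ideal R) [p.IsPrime] (α : {α // 𝔭 α = p}) :
    Submodule.torsionBySet (HomogLoc 𝒜 p) (HomogLocModule 𝒜 p D)
      (locIdeal 𝒜 p : Set (HomogLoc 𝒜 p)) :=
  ⟨LocalizedModule.mk (summandGenerator θ e α) 1, mk_mem_torsionBySet_locIdeal
    (by simpa only [α.2] using summandGenerator_mem_torsionBySet (θ := θ) (e := e) α.1) 1⟩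

theorem mem_locIdeal_of_sum_smul_summandGenerator_eq_zero
    (he : ∀ α, IsStarInjectiveEnvelope 𝒜 (quotGrading 𝒜 (𝔭 α)) (ℰ α) (e α))
    {s : Finset {α // 𝔭 α = p}} {t : {α // 𝔭 α = p} → HomogLoc 𝒜 p}
    (hsum : ∑ α ∈ s, t α •
      (LocalizedModule.mk (summandGenerator θ e α) 1 : HomogLocModule 𝒜 p D) = 0)
    {α : {α // 𝔭 α = p}} (hα : α ∈ s) : t α ∈ locIdeal 𝒜 p := by
  let coord : D →ₗ[R] E α := DirectSum.component R Λ E α ∘ₗ θ.toLinearMap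
  have coord_self : coord (summandGenerator θ e α) = e α 1 :=
    (congrArg (DirectSum.component R Λ E α) (map_summandGenerator _)).trans
      (DirectSum.component.lof_self _ _ _)
  have coord_of_ne (β : {α // 𝔭 α = p}) (hβ : β ≠ α) : coord (summandGenerator θ e β) = 0 :=
    (congrArg (DirectSum.component R Λ E α) (map_summandGenerator _)).trans
      (DirectSum.of_eq_of_ne _ _ _ (Subtype.coe_ne_coe.mpr hβ.symm))
  have map_coord := congrArg (LocalizedModule.map (homogCompl 𝒜 p) coord) hsum
  rw [map_zero, map_sum, Finset.sum_eq_single_of_mem α hα, map_smul, LocalizedModule.map_mk,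
    coord_self] at map_coord
  · refine mem_locIdeal_of_smul_mk_eq_zero (fun r hr => ?_) map_coord
    exact α.2.le ((he α).smul_map_one_eq_zero_iff.mp hr)
  · intro β _ hβ
    rw [map_smul, LocalizedModule.map_mk, coord_of_ne β hβ, LocalizedModule.zero_mk, smul_zero]

theorem exists_mk_summand_eq_smul [IsNoetherianRing R]
    {α : Λ} (hα_prime : (𝔭 α).IsPrime) (hα_graded : (𝔭 α).IsHomogeneous 𝒜)
    (he : IsStarInjectiveEnvelope 𝒜 (quotGrading 𝒜 (𝔭 α)) (ℰ α) (e α)) {g k : G} {x : E α}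
    (hx : x ∈ ℰ α (g + k)) (hpx : x ∈ Submodule.torsionBySet R (E α) p) {s : homogCompl 𝒜 p}
    (hs : (s : R) ∈ 𝒜 k) :
    ∃ t ∈ locGrading 𝒜 p g, (LocalizedModule.mk (θ.symm (DirectSum.lof R Λ E α x)) s :
        HomogLocModule 𝒜 p D) = t • LocalizedModule.mk (summandGenerator θ e α) 1 ∧
      (𝔭 α ≠ p → t = 0) := by
  obtain ⟨l, c, hc, hcp, r, hr, hcr, hr0⟩ :=
    he.exists_smul_eq_of_mem_torsionBySet hα_prime hα_graded hx hpx
  let u : homogCompl 𝒜 p := ⟨c, ⟨l, hc⟩, hcp⟩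
  refine ⟨Localization.mk r (u * s), ?_, ?_, fun hα => ?_⟩
  · exact ⟨l + k, r, u * s, by rwa [add_comm l, ← add_assoc], SetLike.GradedMul.mul_mem hc hs, rfl⟩
  · rw [LocalizedModule.mk_smul_mk, mul_one, smul_summandGenerator, ← hcr, map_smul, map_smul]
    exact (LocalizedModule.mk_cancel_common_left u s _).symm
  · rw [hr0 hα, Localization.mk_zero]

theorem exists_sum_smul_summandGenerator_eq [IsNoetherianRing R] [SetLike.GradedSMul 𝒜 𝒟]
    (h𝔭_prime : ∀ α, (𝔭 α).IsPrime) (h𝔭_graded : ∀ α, (𝔭 α).IsHomogeneous 𝒜)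
    (he : ∀ α, IsStarInjectiveEnvelope 𝒜 (quotGrading 𝒜 (𝔭 α)) (ℰ α) (e α))
    (hθ : IsHomog 𝒟 (directSumGrading fun α => shift (ℰ α) (-n α)) θ.toLinearMap)
    {g : G} {x : HomogLocModule 𝒜 p D} (hx : x ∈ locModuleGrading 𝒜 p 𝒟 g)
    (hpx : x ∈ Submodule.torsionBySet (HomogLoc 𝒜 p) (HomogLocModule 𝒜 p D)
      (locIdeal 𝒜 p : Set (HomogLoc 𝒜 p))) :
    ∃ (s : Finset {α // 𝔭 α = p}) (t : {α // 𝔭 α = p} → HomogLoc 𝒜 p),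
      (∀ α : {α // 𝔭 α = p}, t α ∈ locGrading 𝒜 p (g - n α)) ∧
      ∑ α ∈ s, t α • LocalizedModule.mk (summandGenerator θ e α) 1 = x := by
  classical
  obtain ⟨k, y, u, hy, hu, rfl, hpy⟩ := exists_mk_of_mem_torsionBySet hx hpx
  have coord_mem (α : Λ) : θ y α ∈ ℰ α (g - n α + k) := by
    rw [sub_add_eq_add_sub, sub_eq_add_neg]
    exact hθ.mem hy α
  have coord_torsion (α : Λ) : θ y α ∈ Submodule.torsionBySet R (E α) p := by
    refine (Submodule.mem_torsionBySet_iff _ _).mpr fun a => ?_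
    change (a : R) • DirectSum.component R Λ E α (θ y) = 0
    rw [← map_smul, ← map_smul, (Submodule.mem_torsionBySet_iff _ _).mp hpy a, map_zero, map_zero]
  choose t ht mk_coord ht0 using fun α => exists_mk_summand_eq_smul (θ := θ) (p := p) (h𝔭_prime α)
    (h𝔭_graded α) (he α) (coord_mem α) (coord_torsion α) hu
  refine ⟨(DFinsupp.support (θ y)).subtype fun α => 𝔭 α = p, fun α => t α, fun α => ht α, ?_⟩
  have sum_coord : ∑ α ∈ DFinsupp.support (θ y), θ.symm (DirectSum.lof R Λ E α (θ y α)) = y := by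
    rw [← map_sum, LinearEquiv.symm_apply_eq]
    exact DirectSum.sum_support_of (θ y)
  rw [Finset.sum_subtype_eq_sum_filter (f := fun α =>
      t α • (LocalizedModule.mk (summandGenerator θ e α) 1 : HomogLocModule 𝒜 p D)),
    Finset.sum_filter_of_ne fun α _ h => not_not.mp fun hα => h (by rw [ht0 α hα, zero_smul])]
  simp only [← mk_coord]
  rw [← localizedModule_mk_sum, sum_coord]

theorem isHomogeneousBasis_localizedSummandGenerator [IsNoetherianRing R]
    [SetLike.GradedSMul 𝒜 𝒟] (hD : IsGradedModule 𝒜 𝒟)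
    (h𝔭_prime : ∀ α, (𝔭 α).IsPrime) (h𝔭_graded : ∀ α, (𝔭 α).IsHomogeneous 𝒜)
    (he : ∀ α, IsStarInjectiveEnvelope 𝒜 (quotGrading 𝒜 (𝔭 α)) (ℰ α) (e α))
    (hθ : IsHomog 𝒟 (directSumGrading fun α => shift (ℰ α) (-n α)) θ.toLinearMap) :
    IsHomogeneousBasis (quotGrading (locGrading 𝒜 p) (locIdeal 𝒜 p))
      (subGrading (locModuleGrading 𝒜 p 𝒟) (Submodule.torsionBySet (HomogLoc 𝒜 p)
        (HomogLocModule 𝒜 p D) (locIdeal 𝒜 p : Set (HomogLoc 𝒜 p))))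
      (fun α : {α // 𝔭 α = p} => n α) (localizedSummandGenerator 𝒜 θ e p) where
  linearIndependent := linearIndependent_quotient fun s t hsum α hα => by
    refine mem_locIdeal_of_sum_smul_summandGenerator_eq_zero (θ := θ) (t := t) he ?_ hα
    exact (AddSubmonoidClass.coe_finsetSum _ _).symm.trans (congrArg Subtype.val hsum)
  mem α := mk_mem_locModuleGrading (k := 0)
    (by simpa only [add_zero] using summandGenerator_mem hD he hθ α.1) SetLike.GradedOne.one_mem
  exists_sum_eq g y hy := by
    obtain ⟨s, t, ht, hsum⟩ :=
      exists_sum_smul_summandGenerator_eq h𝔭_prime h𝔭_graded he hθ hy y.2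
    refine ⟨s, fun α => Ideal.Quotient.mk _ (t α), fun α => ⟨t α, ht α, rfl⟩, Subtype.ext ?_⟩
    exact (AddSubmonoidClass.coe_finsetSum _ _).trans hsum

end SummandGenerators

section Degrees

variable {G : Type*} [AddCommGroup G] {H : Type*} [AddCommGroup H] {φ : G →+ H}
variable {R : Type*} [CommRing R] {𝒜 : G → AddSubgroup R} {p : Ideal R}

theorem proj_of_mem_regrade [DecidableEq G] {M : Type*} [AddCommGroup M] {ℳ : G → AddSubgroup M}
    (hℳ : DirectSum.IsInternal ℳ) {g : G} {h : H} (hg : φ g ≠ h) {x : M}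
    (hx : x ∈ regrade φ ℳ h) : proj hℳ g x = 0 := by
  refine (iSup_le (a := (proj hℳ g).ker) ?_ : regrade φ ℳ h ≤ _) hx
  rintro ⟨k, rfl⟩ y hy
  exact proj_of_mem_ne hℳ hy fun hkg => hg (congrArg φ hkg.symm)

theorem map_degree_eq_zero_of_closure_eq_top [DecidableEq G] [GradedRing 𝒜] {X : Set R}
    (hX : Subring.closure X = ⊤) (hp : p.IsHomogeneous 𝒜)
    (hgen : ∀ x ∈ X, x ∈ p ∨ ∃ g, φ g = 0 ∧ x ∈ 𝒜 g) {g : G} {x : R} (hx : x ∈ 𝒜 g)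
    (hxp : x ∉ p) : φ g = 0 := by
  let S := SetLike.GradeZero.subring (regrade φ 𝒜)
  have X_subset : X ⊆ (S.map (Ideal.Quotient.mk p)).comap (Ideal.Quotient.mk p) := by
    intro y hy
    obtain hyp | ⟨k, hk, hyk⟩ := hgen y hy
    · exact ⟨0, S.zero_mem, by rw [map_zero, Ideal.Quotient.eq_zero_iff_mem.mpr hyp]⟩
    · exact ⟨y, mem_regrade hk hyk, rfl⟩
  obtain ⟨y, hy, hyx⟩ := Subring.closure_le.mpr X_subset (hX ▸ Subring.mem_top x)
  have hxy : x - y ∈ p := Ideal.Quotient.eq.mp hyx.symm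
  by_contra hg
  have h𝒜 := DirectSum.Decomposition.isInternal 𝒜
  have proj_sub : proj h𝒜 g (x - y) = x := by
    rw [map_sub, proj_of_mem h𝒜 hx, proj_of_mem_regrade h𝒜 hg hy, sub_zero]
  exact hxp (proj_sub ▸ (isGradedSubmodule_of_isHomogeneous hp).proj_mem h𝒜 hxy g)

theorem map_degree_eq_zero_of_mem_locGrading [SetLike.GradedMonoid 𝒜] [p.IsPrime]
    (hφ : ∀ g, ∀ x ∈ 𝒜 g, x ∉ p → φ g = 0) {g : G} {t : HomogLoc 𝒜 p}
    (ht : t ∈ locGrading 𝒜 p g) (htp : t ∉ locIdeal 𝒜 p) : φ g = 0 := by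
  obtain ⟨k, b, s, hb, hs, rfl⟩ := ht
  have φ_add : φ (g + k) = 0 := hφ _ b hb fun hbp => htp (mk_mem_locIdeal hbp s)
  rwa [map_add, hφ k s hs s.2.2, add_zero] at φ_add

theorem map_degree_eq_zero_of_mem_quotGrading {I : Ideal R}
    (hφ : ∀ g, ∀ x ∈ 𝒜 g, x ∉ I → φ g = 0) {g : G} {t : R ⧸ I} (ht : t ∈ quotGrading 𝒜 I g)
    (ht0 : t ≠ 0) : φ g = 0 := by
  obtain ⟨x, hx, rfl⟩ := ht
  exact hφ g x hx fun hxI => ht0 (Ideal.Quotient.eq_zero_iff_mem.mpr hxI)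

end Degrees

theorem dirHom_eq_zero {r : ℕ} {R : Type*} [CommRing R] {𝒜 : (Fin r → ℤ) → AddSubgroup R}
    [GradedRing 𝒜] (hstd : IsStandard 𝒜) {p : Ideal R} (hp : p.IsHomogeneous 𝒜)
    {g : Fin r → ℤ} {x : R} (hx : x ∈ 𝒜 g) (hxp : x ∉ p) : dirHom 𝒜 p g = 0 := by
  classical
  refine map_degree_eq_zero_of_closure_eq_top hstd hp ?_ hx hxp
  rintro y (hy | hy)
  · exact .inr ⟨0, map_zero _, hy⟩
  · obtain ⟨j, hy⟩ := Set.mem_iUnion.mp hy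
    refine or_iff_not_imp_left.mpr fun hyp => ⟨Pi.single j 1, funext fun k => ?_, hy⟩
    have subset_p := (Finset.mem_filter.mp ((dir 𝒜 p).orderEmbOfFin_mem rfl k)).2
    have hkj : (dir 𝒜 p).orderEmbOfFin rfl k ≠ j := by
      rintro rfl
      exact hyp (subset_p hy)
    exact Pi.single_eq_of_ne hkj _

theorem IsHomogeneousBasis.starExt_of_equiv_torsionBySet {G : Type*} [AddCommGroup G]
    [DecidableEq G] {R : Type u} [CommRing R] {𝒜 : G → AddSubgroup R} {I : Ideal R}
    {N : Type u} [AddCommGroup N] [Module R N] {𝒩 : G → AddSubgroup N}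
    {J : StarInjectiveResolution 𝒜 𝒩} {i : ℕ}
    {V : Type u} [AddCommGroup V] [Module R V] {𝒱 : G → AddSubgroup V}
    {ι : Type u} {n : ι → G} {w : ι → Submodule.torsionBySet R V (I : Set R)}
    (hw : IsHomogeneousBasis (quotGrading 𝒜 I)
      (subGrading 𝒱 (Submodule.torsionBySet R V (I : Set R))) n w)
    (Ψ : StarExt (quotGrading 𝒜 I) J i ≃ₗ[R] Submodule.torsionBySet R V (I : Set R))
    (hΨ : ∀ g x, (Ψ x : V) ∈ 𝒱 g ↔ x ∈ StarExt.grading (quotGrading 𝒜 I) J i g) :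
    IsHomogeneousBasis (quotGrading 𝒜 I) (StarExt.grading (quotGrading 𝒜 I) J i) n
      (Ψ.symm ∘ w) := by
  have := Module.IsTorsionBySet.isScalarTower (S := R) (StarExt.isTorsionBySet J I i)
  refine hw.map (Ψ.extendScalarsOfSurjective Ideal.Quotient.mk_surjective).symm fun g x => ?_
  refine (hΨ g _).symm.trans (iff_of_eq (congrArg (· ∈ 𝒱 g) ?_))
  exact congrArg Subtype.val (Ψ.apply_symm_apply x)

end MultiGraded

end

open MultiGraded in
theorem theorem2p6_general {G : Type*} [AddCommGroup G] [DecidableEq G]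
    {R : Type u} [CommRing R] [IsNoetherianRing R] (𝒜 : G → AddSubgroup R) [GradedRing 𝒜]
    {M : Type u} [AddCommGroup M] [Module R M] (ℳ : G → AddSubgroup M)
    [DirectSum.Decomposition ℳ] [SetLike.GradedSMul 𝒜 ℳ]
    (I : StarInjectiveResolution 𝒜 ℳ) (hI : I.IsMinimal) (i : ℕ)
    {Λ : Type u} (𝔭 : Λ → Ideal R) (n : Λ → G)
    (h𝔭_prime : ∀ α, (𝔭 α).IsPrime) (h𝔭_graded : ∀ α, (𝔭 α).IsHomogeneous 𝒜)
    (E : Λ → Type u) [∀ α, AddCommGroup (E α)] [∀ α, Module R (E α)]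
    (ℰ : ∀ α, G → AddSubgroup (E α)) (e : ∀ α, (R ⧸ 𝔭 α) →ₗ[R] E α)
    (he : ∀ α, IsStarInjectiveEnvelope 𝒜 (quotGrading 𝒜 (𝔭 α)) (ℰ α) (e α))
    (θ : I.obj i ≃ₗ[R] DirectSum Λ E)
    (hθ : IsHomog (I.grading i) (directSumGrading fun α => shift (ℰ α) (-n α)) θ.toLinearMap)
    (p : Ideal R) [p.IsPrime] (hp_graded : p.IsHomogeneous 𝒜)
    {H : Type*} [AddCommGroup H] (φ : G →+ H) (hφ : ∀ g, ∀ x ∈ 𝒜 g, x ∉ p → φ g = 0) (a : H) :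
    Nonempty (StarInjectiveResolution (locGrading 𝒜 p) (locModuleGrading 𝒜 p ℳ)) ∧
    ∀ J : StarInjectiveResolution (locGrading 𝒜 p) (locModuleGrading 𝒜 p ℳ),
      Module.Free (quotRegradedZero (locGrading 𝒜 p) (locIdeal 𝒜 p) φ)
        (StarExt.regradedComponent J (locIdeal 𝒜 p) φ i a) ∧
      Cardinal.mk {α : Λ // 𝔭 α = p ∧ φ (n α) = a} =
        Module.rank (quotRegradedZero (locGrading 𝒜 p) (locIdeal 𝒜 p) φ)
          (StarExt.regradedComponent J (locIdeal 𝒜 p) φ i a) := by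
  classical
  have hM : IsGradedModule 𝒜 ℳ := .of_decomposition
  refine ⟨⟨I.localized p⟩, fun J => ?_⟩
  obtain ⟨Ψ, hΨ⟩ := StarExt.exists_equiv_torsionBySet (K := I.localized p)
    (isGradedSubmodule_locIdeal hp_graded)
    (fun i x hx => hI.localized_d_eq_zero hM hp_graded hx) (hM.localized p) J i
  have basis := (isHomogeneousBasis_localizedSummandGenerator (p := p) (I.graded i) h𝔭_prime
    h𝔭_graded he hθ).starExt_of_equiv_torsionBySet Ψ hΨ
  have := Ideal.Quotient.nontrivial_iff.mpr (locIdeal_ne_top 𝒜 p)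
  have degree_eq_zero (g) : ∀ t ∈ quotGrading (locGrading 𝒜 p) (locIdeal 𝒜 p) g, t ≠ 0 → φ g = 0 :=
    fun _ => map_degree_eq_zero_of_mem_quotGrading fun _ _ =>
      map_degree_eq_zero_of_mem_locGrading hφ
  obtain ⟨free, mk_eq_rank⟩ := basis.free_and_mk_eq_rank
    (P := StarExt.regradedComponent J (locIdeal 𝒜 p) φ i a) degree_eq_zero fun _ => Iff.rfl
  refine ⟨free, mk_eq_rank ▸ Cardinal.mk_congr ?_⟩
  exact (Equiv.subtypeSubtypeEquivSubtypeInter (𝔭 · = p) fun α => φ (n α) = a).symm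

theorem theorem2p6 {r : ℕ} {R : Type u} [CommRing R] [IsNoetherianRing R]
    (𝒜 : (Fin r → ℤ) → AddSubgroup R) [GradedRing 𝒜]
    (hpos : MultiGraded.IsPositivelyGraded 𝒜) (hstd : MultiGraded.IsStandard 𝒜)
    {M : Type u} [AddCommGroup M] [Module R M]
    (ℳ : (Fin r → ℤ) → AddSubgroup M) [DirectSum.Decomposition ℳ] [SetLike.GradedSMul 𝒜 ℳ]
    -- the minimal *injective resolution of `M`
    (I : MultiGraded.StarInjectiveResolution 𝒜 ℳ) (hI : I.IsMinimal)
    (i : ℕ)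
    -- the decomposition of its `i`-th term as the direct sum of the `*E(R/𝔭_α)(-n_α)`
    {Λ : Type u} (𝔭 : Λ → Ideal R) (n : Λ → Fin r → ℤ)
    (h𝔭_prime : ∀ α, (𝔭 α).IsPrime) (h𝔭_graded : ∀ α, (𝔭 α).IsHomogeneous 𝒜)
    (E : Λ → Type u) [∀ α, AddCommGroup (E α)] [∀ α, Module R (E α)]
    (ℰ : ∀ α, (Fin r → ℤ) → AddSubgroup (E α))
    (e : ∀ α, (R ⧸ 𝔭 α) →ₗ[R] E α)
    (he : ∀ α, MultiGraded.IsStarInjectiveEnvelope 𝒜 (MultiGraded.quotGrading 𝒜 (𝔭 α)) (ℰ α) (e α))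
    (θ : I.obj i ≃ₗ[R] DirectSum Λ E)
    (hθ : MultiGraded.IsHomog (I.grading i)
      (MultiGraded.directSumGrading fun α => MultiGraded.shift (ℰ α) (-n α)) θ.toLinearMap)
    -- a graded prime containing `R_1`
    (p : Ideal R) [p.IsPrime] (hp_graded : p.IsHomogeneous 𝒜)
    (hp : Ideal.span (𝒜 1 : Set R) ≤ p)
    (a : Fin (MultiGraded.dir 𝒜 p).card → ℤ) :
    -- `M_(p)` has a *injective resolution over `R_(p)`, and each one of them can be used to form
    -- the module `*Ext^i`
    Nonempty (MultiGraded.StarInjectiveResolution (MultiGraded.locGrading 𝒜 p)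
      (MultiGraded.locModuleGrading 𝒜 p ℳ)) ∧
    ∀ J : MultiGraded.StarInjectiveResolution (MultiGraded.locGrading 𝒜 p)
        (MultiGraded.locModuleGrading 𝒜 p ℳ),
      Module.Free
        (MultiGraded.quotRegradedZero (MultiGraded.locGrading 𝒜 p) (MultiGraded.locIdeal 𝒜 p)
          (MultiGraded.dirHom 𝒜 p))
        (MultiGraded.StarExt.regradedComponent J (MultiGraded.locIdeal 𝒜 p)
          (MultiGraded.dirHom 𝒜 p) i a) ∧
      Cardinal.mk {α : Λ // 𝔭 α = p ∧ MultiGraded.dirHom 𝒜 p (n α) = a} =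
        Module.rank
          (MultiGraded.quotRegradedZero (MultiGraded.locGrading 𝒜 p) (MultiGraded.locIdeal 𝒜 p)
            (MultiGraded.dirHom 𝒜 p))
          (MultiGraded.StarExt.regradedComponent J (MultiGraded.locIdeal 𝒜 p)
            (MultiGraded.dirHom 𝒜 p) i a) := by
  exact theorem2p6_general 𝒜 ℳ I hI i 𝔭 n h𝔭_prime h𝔭_graded E ℰ e he θ hθ p hp_graded
    (MultiGraded.dirHom 𝒜 p) (fun _ _ => MultiGraded.dirHom_eq_zero hstd hp_graded) a
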